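/- **Setting.** Let $\Lambda\subseteq\mathbb R$ be a nonempty set with the induced order. A weight matrix is a family $\mathfrak M=\{M^\lambda:\lambda\in\Lambda\}$ of sequences $M^\lambda=(M^\lambda_k)_{k\ge 0}$ of positive reals such that each $(k!\,M^\lambda_k)_k$ is log-convex, $M^\lambda_0=1$, $\lim_k (k!\,M^\lambda_k)^{1/k}=\infty$, and $M^\lambda_k\le M^\mu_k$ for all $k$ if $\lambda\le\mu$. For sequences of positive reals write $M\preceq N$ if there are $C,\rho>0$ with $M_k\le C\rho^kN_k$ for all $k$, and let $M^\circ_0:=1$ and, for $k\ge1$, $M^\circ_k:=\max\{M_jM_{\alpha_1}\cdots M_{\alpha_j}: j\ge 1,\ \alpha_i\in\mathbb N_{>0},\ \alpha_1+\dots+\alpha_j=k\}$. Consider the conditions $$(\mathfrak M_{(\mathrm{FdB})})\ \ \forall\lambda\in\Lambda\ \exists\mu\in\Lambda:\ (M^\mu)^\circ\preceq M^\lambda,\qquad (\mathfrak M_{\{\mathrm{FdB}\}})\ \ \forall\lambda\in\Lambda\ \exists\mu\in\Lambda:\ (M^\lambda)^\circ\preceq M^\mu .$$ For compact $K\subseteq\mathbb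 R^p$, $\rho>0$ and a positive sequence $M$ put $$\|f\|^M_{K,\rho}:=\sup\Big\{\frac{\|f^{(k)}(x)\|}{k!\,\rho^kM_k}: x\in K,\ k\in\mathbb N\Big\}\in[0,\infty],$$ with the Euclidean operator norm of the $k$-th Fréchet derivative. The Beurling space $\mathcal E^{(\mathfrak M)}(\mathbb R^p,\mathbb R^m)$ is the space of all $f\in C^\infty(\mathbb R^p,\mathbb R^m)$ with $\|f\|^{M^\lambda}_{K,\rho}<\infty$ for all $\lambda\in\Lambda$, all compact $K\subseteq\mathbb R^p$ and all $\rho>0$, with the locally convex topology defined by all these seminorms. The Roumieu space $\mathcal E^{\{\mathfrak M\}}(\mathbb R^p,\mathbb R^m)$ is the space of all $f\in C^\infty(\mathbb R^p,\mathbb R^m)$ such that for every compact $K\subseteq\mathbb R^p$ there are $\lambda\in\Lambda$ and $\rho>0$ with $\|f\|^{M^\lambda}_{K,\rho}<\infty$. Its topology is defined as follows. For a closed ball $K$, let $\mathcal E^{M}_\rho(K,\mathbb R^m)$ be the Banach space of all $f\in C^\infty(K,\mathbb R^m)$ (smooth in the interior, with all derivatives extending continuously to $K$) with $\|f\|^M_{K,\rho}<\infty$;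 let $\mathcal E^{\{\mathfrak M\}}(K,\mathbb R^m):=\bigcup_{\lambda\in\Lambda,\rho>0}\mathcal E^{M^\lambda}_\rho(K,\mathbb R^m)$ carry the inductive limit topology, i.e. the finest locally convex topology for which the inclusions of all $\mathcal E^{M^\lambda}_\rho(K,\mathbb R^m)$ are continuous; and let $\mathcal E^{\{\mathfrak M\}}(\mathbb R^p,\mathbb R^m)$ carry the projective limit topology, i.e. the coarsest topology for which all the restriction maps to $\mathcal E^{\{\mathfrak M\}}(K,\mathbb R^m)$ are continuous, where $K$ runs through the closed balls of radius $1,2,3,\dots$ about $0$. **Theorem.** Let $\mathfrak M$ be a weight matrix and $p,q,r\in\mathbb N$. (1) If $\mathfrak M$ satisfies $(\mathfrak M_{(\mathrm{FdB})})$, then $f\circ g\in\mathcal E^{(\mathfrak M)}(\mathbb R^p,\mathbb R^r)$ for all $g\in\mathcal E^{(\mathfrak M)}(\mathbb R^p,\mathbb R^q)$ and $f\in\mathcal E^{(\mathfrak M)}(\mathbb R^q,\mathbb R^r)$, and the map $$\mathcal E^{(\mathfrak M)}(\mathbb R^p,\mathbb R^q)\times\mathcal E^{(\mathfrak M)}(\mathbb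 R^q,\mathbb R^r)\to\mathcal E^{(\mathfrak M)}(\mathbb R^p,\mathbb R^r),\quad (g,f)\mapsto f\circ g,$$ is continuous. (2) If $\mathfrak M$ satisfies $(\mathfrak M_{\{\mathrm{FdB}\}})$, then $f\circ g\in\mathcal E^{\{\mathfrak M\}}(\mathbb R^p,\mathbb R^r)$ for all $g\in\mathcal E^{\{\mathfrak M\}}(\mathbb R^p,\mathbb R^q)$ and $f\in\mathcal E^{\{\mathfrak M\}}(\mathbb R^q,\mathbb R^r)$; for each fixed $f\in\mathcal E^{\{\mathfrak M\}}(\mathbb R^q,\mathbb R^r)$ the map $\mathcal E^{\{\mathfrak M\}}(\mathbb R^p,\mathbb R^q)\to\mathcal E^{\{\mathfrak M\}}(\mathbb R^p,\mathbb R^r)$, $g\mapsto f\circ g$, is continuous; and the map $$\mathcal E^{\{\mathfrak M\}}(\mathbb R^p,\mathbb R^q)\times\mathcal E^{\{\mathfrak M\}}(\mathbb R^q,\mathbb R^r)\to\mathcal E^{\{\mathfrak M\}}(\mathbb R^p,\mathbb R^r),\quad (g,f)\mapsto f\circ g,$$ is sequentially continuous. -/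

import Mathlib

open scoped ENNReal Nat ContDiff Topology

namespace Ultra

/-! ### Sequences and weight matrices -/

/-- `M ⪯ N`: there are `C, ρ > 0` with `M k ≤ C ρ ^ k N k` for all `k`. -/
def Dominated (M N : ℕ → ℝ) : Prop :=
  ∃ C > 0, ∃ ρ > 0, ∀ k, M k ≤ C * ρ ^ k * N k

/-- The sequence `M°`: `M° 0 = 1`, and for `k ≥ 1`, `M° k` is the maximum of
`M j * M α₁ * ⋯ * M αⱼ` over all compositions `k = α₁ + ⋯ + αⱼ` into positive integers. -/
noncomputable def circ (M : ℕ → ℝ) (k : ℕ) : ℝ :=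
  if k = 0 then 1 else
    Finset.univ.sup' Finset.univ_nonempty
      (fun c : Composition k => M c.length * ∏ i, M (c.blocksFun i))

/-- A weight matrix, indexed by a nonempty set `Λ` of reals with the induced order. -/
structure WeightMatrix (Λ : Set ℝ) where
  /-- the sequences `M^λ` -/
  seq : Λ → ℕ → ℝ
  nonempty : Λ.Nonempty
  pos : ∀ l k, 0 < seq l k
  /-- weak log-convexity: `k ↦ k! M_k^λ` is log-convex -/
  weaklyLogConvex : ∀ l k, ((k + 1)! * seq l (k + 1)) ^ 2 ≤
    (k ! * seq l k) * ((k + 2)! * seq l (k + 2))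
  zero_eq_one : ∀ l, seq l 0 = 1
  tendsto_root : ∀ l, Filter.Tendsto (fun k : ℕ => (k ! * seq l k) ^ (1 / (k : ℝ)))
    Filter.atTop Filter.atTop
  mono : ∀ l m, l ≤ m → ∀ k, seq l k ≤ seq m k

/-- The Beurling type (FdB)-condition: for all `λ` there is `μ` with `(M^μ)° ⪯ M^λ`. -/
def WeightMatrix.FdBBeurling {Λ : Set ℝ} (𝔐 : WeightMatrix Λ) : Prop :=
  ∀ l : Λ, ∃ m : Λ, Dominated (circ (𝔐.seq m)) (𝔐.seq l)

/-- The Roumieu type (FdB)-condition: for all `λ` there is `μ` with `(M^λ)° ⪯ M^μ`. -/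
def WeightMatrix.FdBRoumieu {Λ : Set ℝ} (𝔐 : WeightMatrix Λ) : Prop :=
  ∀ l : Λ, ∃ m : Λ, Dominated (circ (𝔐.seq l)) (𝔐.seq m)

/-! ### The (possibly infinite) norms `‖f‖_{K,ρ}^M` -/

section Norms

variable {E F : Type*} [NormedAddCommGroup E] [NormedSpace ℝ E]
  [NormedAddCommGroup F] [NormedSpace ℝ F]

/-- The quantity `sup {‖P_k(x)‖ / (k! ρ^k M_k) : x ∈ K, k ∈ ℕ}` in `[0, ∞]`, where `P_k(x)` is the
`k`-th derivative at `x` of the function under consideration. -/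
noncomputable def ultraNorm (M : ℕ → ℝ) (ρ : ℝ) (K : Set E)
    (P : ∀ k : ℕ, E → E [×k]→L[ℝ] F) : ℝ≥0∞ :=
  ⨆ x ∈ K, ⨆ k : ℕ, ENNReal.ofReal (‖P k x‖ / (k ! * ρ ^ k * M k))

theorem le_ultraNorm (M : ℕ → ℝ) (ρ : ℝ) {K : Set E} (P : ∀ k : ℕ, E → E [×k]→L[ℝ] F)
    {x : E} (hx : x ∈ K) (k : ℕ) :
    ENNReal.ofReal (‖P k x‖ / (k ! * ρ ^ k * M k)) ≤ ultraNorm M ρ K P :=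
  le_iSup₂_of_le x hx (le_iSup (fun k => ENNReal.ofReal (‖P k x‖ / (k ! * ρ ^ k * M k))) k)

theorem ultraNorm_zero (M : ℕ → ℝ) (ρ : ℝ) (K : Set E)
    {P : ∀ k : ℕ, E → E [×k]→L[ℝ] F} (h : ∀ x ∈ K, ∀ k, P k x = 0) :
    ultraNorm M ρ K P = 0 := by
  simp only [ultraNorm, ENNReal.iSup_eq_zero]
  intro x hx k
  simp [h x hx k]

theorem ultraNorm_add_le (M : ℕ → ℝ) (ρ : ℝ) (K : Set E)
    {P Q R : ∀ k : ℕ, E → E [×k]→L[ℝ] F} (h : ∀ x ∈ K, ∀ k, R k x = P k x + Q k x) :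
    ultraNorm M ρ K R ≤ ultraNorm M ρ K P + ultraNorm M ρ K Q := by
  refine iSup₂_le fun x hx => iSup_le fun k => ?_
  refine le_trans ?_ (add_le_add (le_ultraNorm M ρ P hx k) (le_ultraNorm M ρ Q hx k))
  rw [h x hx k]
  rcases le_total 0 (k ! * ρ ^ k * M k) with hd | hd
  · refine le_trans (ENNReal.ofReal_le_ofReal ?_) ENNReal.ofReal_add_le
    rw [← add_div]
    exact div_le_div_of_nonneg_right (norm_add_le _ _) hd
  · rw [ENNReal.ofReal_of_nonpos (div_nonpos_of_nonneg_of_nonpos (norm_nonneg _) hd)]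
    exact zero_le

theorem ultraNorm_smul_le (M : ℕ → ℝ) (ρ : ℝ) (K : Set E) (c : ℝ)
    {P R : ∀ k : ℕ, E → E [×k]→L[ℝ] F} (h : ∀ x ∈ K, ∀ k, R k x = c • P k x) :
    ultraNorm M ρ K R ≤ ‖c‖ₑ * ultraNorm M ρ K P := by
  refine iSup₂_le fun x hx => iSup_le fun k => ?_
  rw [h x hx k, norm_smul, mul_div_assoc, ENNReal.ofReal_mul (norm_nonneg _), ofReal_norm]
  gcongr
  exact le_ultraNorm M ρ P hx k

theorem ultraNorm_congr (M : ℕ → ℝ) (ρ : ℝ) (K : Set E)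
    {P R : ∀ k : ℕ, E → E [×k]→L[ℝ] F} (h : ∀ x ∈ K, ∀ k, R k x = P k x) :
    ultraNorm M ρ K R = ultraNorm M ρ K P :=
  iSup_congr fun x => iSup_congr fun hx => iSup_congr fun k => by rw [h x hx k]

theorem ultraNorm_mono {M N : ℕ → ℝ} (hM : ∀ k, 0 < M k) (hMN : ∀ k, M k ≤ N k) {ρ σ : ℝ}
    (hρ : 0 < ρ) (hρσ : ρ ≤ σ) (K : Set E) (P : ∀ k : ℕ, E → E [×k]→L[ℝ] F) :
    ultraNorm N σ K P ≤ ultraNorm M ρ K P := by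
  refine iSup₂_mono fun x _ => iSup_mono fun k => ENNReal.ofReal_le_ofReal ?_
  have := hM k
  have := hMN k
  have hσ : 0 ≤ σ := hρ.le.trans hρσ
  gcongr

end Norms

/-- `ℝⁿ` with its Euclidean norm. -/
abbrev Eu (n : ℕ) := EuclideanSpace ℝ (Fin n)

/-! ### The Beurling space `ℰ^{(𝔐)}(ℝᵖ, ℝᵐ)` -/

section Beurling

variable {Λ : Set ℝ} (𝔐 : WeightMatrix Λ) (p m : ℕ)

/-- The smooth maps `f : ℝᵖ → ℝᵐ` with `‖f‖_{K,ρ}^{M^λ} < ∞` for all `λ`, all compact `K` and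
all `ρ > 0`. -/
def beurlingSubmodule : Submodule ℝ (Eu p → Eu m) where
  carrier := {f | ContDiff ℝ ∞ f ∧ ∀ l : Λ, ∀ K : Set (Eu p), IsCompact K → ∀ ρ : ℝ, 0 < ρ →
    ultraNorm (𝔐.seq l) ρ K (fun k => iteratedFDeriv ℝ k f) < ⊤}
  zero_mem' := ⟨contDiff_const, fun l K _ ρ _ => by
    rw [ultraNorm_zero]
    · exact ENNReal.zero_lt_top
    · intro x _ k
      exact congrFun iteratedFDeriv_fun_zero x⟩
  add_mem' := by
    rintro f g ⟨hf, hf'⟩ ⟨hg, hg'⟩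
    refine ⟨hf.add hg, fun l K hK ρ hρ => lt_of_le_of_lt (ultraNorm_add_le _ _ _ ?_)
      (ENNReal.add_lt_top.2 ⟨hf' l K hK ρ hρ, hg' l K hK ρ hρ⟩)⟩
    intro x _ k
    exact iteratedFDeriv_add_apply (hf.of_le (mod_cast le_top)).contDiffAt
      (hg.of_le (mod_cast le_top)).contDiffAt
  smul_mem' := by
    rintro c f ⟨hf, hf'⟩
    refine ⟨hf.const_smul c, fun l K hK ρ hρ => lt_of_le_of_lt (ultraNorm_smul_le _ _ _ c ?_)
      (ENNReal.mul_lt_top enorm_lt_top (hf' l K hK ρ hρ))⟩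
    intro x _ k
    exact iteratedFDeriv_const_smul_apply (hf.of_le (mod_cast le_top)).contDiffAt

/-- The Beurling space `ℰ^{(𝔐)}(ℝᵖ, ℝᵐ)`; its topology is not that of pointwise convergence but
the one defined below. -/
def WeightMatrix.Beurling : Type := beurlingSubmodule 𝔐 p m

noncomputable instance : AddCommGroup (𝔐.Beurling p m) :=
  inferInstanceAs (AddCommGroup (beurlingSubmodule 𝔐 p m))

noncomputable instance : Module ℝ (𝔐.Beurling p m) :=
  inferInstanceAs (Module ℝ (beurlingSubmodule 𝔐 p m))

instance : CoeFun (𝔐.Beurling p m) (fun _ => Eu p → Eu m) := ⟨Subtype.val⟩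

variable {p m} in
/-- The seminorm `f ↦ ‖f‖_{K,ρ}^{M^λ}` on `ℰ^{(𝔐)}(ℝᵖ, ℝᵐ)`. -/
noncomputable def beurlingSeminorm (l : Λ) (K : TopologicalSpace.Compacts (Eu p))
    (ρ : Set.Ioi (0 : ℝ)) : Seminorm ℝ (𝔐.Beurling p m) :=
  Seminorm.ofSMulLE
    (fun f => (ultraNorm (𝔐.seq l) ρ K (fun k => iteratedFDeriv ℝ k (f : Eu p → Eu m))).toReal)
    (by
      have h : ultraNorm (𝔐.seq l) ρ K
          (fun k => iteratedFDeriv ℝ k ((0 : 𝔐.Beurling p m) : Eu p → Eu m)) = 0 :=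
        ultraNorm_zero _ _ _ fun x _ k => congrFun iteratedFDeriv_fun_zero x
      simp [h])
    (by
      intro f g
      have hf := f.2.2 l K K.isCompact ρ ρ.2
      have hg := g.2.2 l K K.isCompact ρ ρ.2
      rw [← ENNReal.toReal_add hf.ne hg.ne]
      refine ENNReal.toReal_mono (ENNReal.add_lt_top.2 ⟨hf, hg⟩).ne (ultraNorm_add_le _ _ _ ?_)
      intro x _ k
      exact iteratedFDeriv_add_apply (f.2.1.of_le (mod_cast le_top)).contDiffAt
        (g.2.1.of_le (mod_cast le_top)).contDiffAt)
    (by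
      intro c f
      have hf := f.2.2 l K K.isCompact ρ ρ.2
      rw [← toReal_enorm c, ← ENNReal.toReal_mul]
      refine ENNReal.toReal_mono (ENNReal.mul_lt_top enorm_lt_top hf).ne
        (ultraNorm_smul_le _ _ _ c ?_)
      intro x _ k
      exact iteratedFDeriv_const_smul_apply (f.2.1.of_le (mod_cast le_top)).contDiffAt)

/-- The natural topology of `ℰ^{(𝔐)}(ℝᵖ, ℝᵐ)`: the locally convex topology defined by all the
seminorms `‖·‖_{K,ρ}^{M^λ}`. -/
noncomputable instance : TopologicalSpace (𝔐.Beurling p m) :=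
  ⨅ i : Λ × TopologicalSpace.Compacts (Eu p) × Set.Ioi (0 : ℝ),
    (beurlingSeminorm 𝔐 i.1 i.2.1 i.2.2).toSeminormedAddCommGroup.toUniformSpace.toTopologicalSpace

end Beurling

/-! ### The Roumieu space `ℰ^{\{𝔐\}}(ℝᵖ, ℝᵐ)` -/

section Roumieu

variable {Λ : Set ℝ} (𝔐 : WeightMatrix Λ) (p m n : ℕ)

/-- The exhaustion of `ℝᵖ` by the closed balls of radius `n + 1`, `n ∈ ℕ`. These compact sets have
smooth boundary and are cofinal among all compact subsets. -/
def ball : Set (Eu p) := Metric.closedBall 0 (n + 1)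

theorem isCompact_ball : IsCompact (ball p n) := isCompact_closedBall _ _

theorem uniqueDiffOn_ball : UniqueDiffOn ℝ (ball p n) := by
  have h : (0 : ℝ) < n + 1 := by positivity
  refine uniqueDiffOn_convex (convex_closedBall _ _) ⟨0, ?_⟩
  exact Metric.ball_subset_interior_closedBall (Metric.mem_ball_self h)

/-- The Banach space `ℰ_ρ^M(K, ℝᵐ)` for the closed ball `K` of radius `n + 1`, as a set of
functions: the functions of class `C^∞` on `K` (all derivatives extend continuously to `K`) with
`‖f‖_{K,ρ}^M < ∞`. A function on `K` is represented by its extension by zero to `ℝᵖ`. -/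
def stepSubmodule (M : ℕ → ℝ) (ρ : ℝ) : Submodule ℝ (Eu p → Eu m) where
  carrier := {f | ContDiffOn ℝ ∞ f (ball p n) ∧ (∀ x ∉ ball p n, f x = 0) ∧
    ultraNorm M ρ (ball p n) (fun k => iteratedFDerivWithin ℝ k f (ball p n)) < ⊤}
  zero_mem' := ⟨contDiffOn_const, fun _ _ => rfl, by
    rw [ultraNorm_zero]
    · exact ENNReal.zero_lt_top
    · intro x _ k
      exact congrFun iteratedFDerivWithin_fun_zero x⟩
  add_mem' := by
    rintro f g ⟨hf, hf0, hf'⟩ ⟨hg, hg0, hg'⟩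
    refine ⟨hf.add hg, fun x hx => by simp [hf0 x hx, hg0 x hx],
      lt_of_le_of_lt (ultraNorm_add_le _ _ _ ?_) (ENNReal.add_lt_top.2 ⟨hf', hg'⟩)⟩
    intro x hx k
    exact iteratedFDerivWithin_add_apply ((hf x hx).of_le (mod_cast le_top))
      ((hg x hx).of_le (mod_cast le_top)) (uniqueDiffOn_ball p n) hx
  smul_mem' := by
    rintro c f ⟨hf, hf0, hf'⟩
    refine ⟨hf.const_smul c, fun x hx => by simp [hf0 x hx],
      lt_of_le_of_lt (ultraNorm_smul_le _ _ _ c ?_) (ENNReal.mul_lt_top enorm_lt_top hf')⟩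
    intro x hx k
    exact iteratedFDerivWithin_const_smul_apply ((hf x hx).of_le (mod_cast le_top))
      (uniqueDiffOn_ball p n) hx

/-- The space `ℰ_ρ^M(K, ℝᵐ)`, `K` the closed ball of radius `n + 1`, to be normed by
`‖·‖_{K,ρ}^M`. -/
def Step (M : ℕ → ℝ) (ρ : ℝ) : Type := stepSubmodule p m n M ρ

noncomputable instance (M : ℕ → ℝ) (ρ : ℝ) : AddCommGroup (Step p m n M ρ) :=
  inferInstanceAs (AddCommGroup (stepSubmodule p m n M ρ))

noncomputable instance (M : ℕ → ℝ) (ρ : ℝ) : Module ℝ (Step p m n M ρ) :=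
  inferInstanceAs (Module ℝ (stepSubmodule p m n M ρ))

/-- The norm `‖·‖_{K,ρ}^M` on `ℰ_ρ^M(K, ℝᵐ)`. -/
noncomputable def stepNorm (M : ℕ → ℝ) (ρ : ℝ) : Seminorm ℝ (Step p m n M ρ) :=
  Seminorm.ofSMulLE
    (fun f => (ultraNorm M ρ (ball p n) (fun k => iteratedFDerivWithin ℝ k f.1 (ball p n))).toReal)
    (by
      have h : ultraNorm M ρ (ball p n)
          (fun k => iteratedFDerivWithin ℝ k (0 : Step p m n M ρ).1 (ball p n)) = 0 :=
        ultraNorm_zero _ _ _ fun x _ k => congrFun iteratedFDerivWithin_fun_zero x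
      simp [h])
    (by
      intro f g
      rw [← ENNReal.toReal_add f.2.2.2.ne g.2.2.2.ne]
      refine ENNReal.toReal_mono (ENNReal.add_lt_top.2 ⟨f.2.2.2, g.2.2.2⟩).ne
        (ultraNorm_add_le _ _ _ ?_)
      intro x hx k
      exact iteratedFDerivWithin_add_apply ((f.2.1 x hx).of_le (mod_cast le_top))
        ((g.2.1 x hx).of_le (mod_cast le_top)) (uniqueDiffOn_ball p n) hx)
    (by
      intro c f
      rw [← toReal_enorm c, ← ENNReal.toReal_mul]
      refine ENNReal.toReal_mono (ENNReal.mul_lt_top enorm_lt_top f.2.2.2).ne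
        (ultraNorm_smul_le _ _ _ c ?_)
      intro x hx k
      exact iteratedFDerivWithin_const_smul_apply ((f.2.1 x hx).of_le (mod_cast le_top))
        (uniqueDiffOn_ball p n) hx)

/-- The topology of `ℰ_ρ^M(K, ℝᵐ)` is the norm topology. -/
noncomputable instance (M : ℕ → ℝ) (ρ : ℝ) : TopologicalSpace (Step p m n M ρ) :=
  (stepNorm p m n M ρ).toSeminormedAddCommGroup.toUniformSpace.toTopologicalSpace

/-- The union `ℰ^{\{𝔐\}}(K, ℝᵐ)` of all `ℰ_ρ^{M^λ}(K, ℝᵐ)`, `λ ∈ Λ`, `ρ > 0`, where `K` is the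
closed ball of radius `n + 1`. -/
def localSubmodule : Submodule ℝ (Eu p → Eu m) where
  carrier := {f | ∃ l : Λ, ∃ ρ : ℝ, 0 < ρ ∧ f ∈ stepSubmodule p m n (𝔐.seq l) ρ}
  zero_mem' := ⟨⟨_, 𝔐.nonempty.some_mem⟩, 1, one_pos, zero_mem _⟩
  add_mem' := by
    rintro f g ⟨l, ρ, hρ, hf⟩ ⟨l', ρ', hρ', hg⟩
    refine ⟨max l l', max ρ ρ', lt_max_of_lt_left hρ, add_mem ?_ ?_⟩
    · exact ⟨hf.1, hf.2.1, lt_of_le_of_lt (ultraNorm_mono (𝔐.pos l)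
        (𝔐.mono _ _ (le_max_left _ _)) hρ (le_max_left _ _) _ _) hf.2.2⟩
    · exact ⟨hg.1, hg.2.1, lt_of_le_of_lt (ultraNorm_mono (𝔐.pos l')
        (𝔐.mono _ _ (le_max_right _ _)) hρ' (le_max_right _ _) _ _) hg.2.2⟩
  smul_mem' := by
    rintro c f ⟨l, ρ, hρ, hf⟩
    exact ⟨l, ρ, hρ, Submodule.smul_mem _ c hf⟩

/-- The space `ℰ^{\{𝔐\}}(K, ℝᵐ)`, `K` the closed ball of radius `n + 1`. -/
def WeightMatrix.RoumieuLocal : Type := localSubmodule 𝔐 p m n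

noncomputable instance : AddCommGroup (𝔐.RoumieuLocal p m n) :=
  inferInstanceAs (AddCommGroup (localSubmodule 𝔐 p m n))

noncomputable instance : Module ℝ (𝔐.RoumieuLocal p m n) :=
  inferInstanceAs (Module ℝ (localSubmodule 𝔐 p m n))

/-- The inclusion of `ℰ_ρ^{M^λ}(K, ℝᵐ)` into `ℰ^{\{𝔐\}}(K, ℝᵐ)`. -/
def stepInclusion (l : Λ) (ρ : Set.Ioi (0 : ℝ)) (f : Step p m n (𝔐.seq l) ρ) :
    𝔐.RoumieuLocal p m n :=
  ⟨f.1, l, ρ, ρ.2, f.2⟩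

/-- The inductive limit topology of `ℰ^{\{𝔐\}}(K, ℝᵐ)`: the finest locally convex topology for
which all the inclusions of the Banach spaces `ℰ_ρ^{M^λ}(K, ℝᵐ)` are continuous. -/
noncomputable instance : TopologicalSpace (𝔐.RoumieuLocal p m n) :=
  sInf {t : TopologicalSpace (𝔐.RoumieuLocal p m n) |
    (∀ (l : Λ) (ρ : Set.Ioi (0 : ℝ)), Continuous[inferInstance, t] (stepInclusion 𝔐 p m n l ρ)) ∧
    @IsTopologicalAddGroup (𝔐.RoumieuLocal p m n) t _ ∧
    @ContinuousSMul ℝ (𝔐.RoumieuLocal p m n) _ _ t ∧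
    @LocallyConvexSpace ℝ (𝔐.RoumieuLocal p m n) _ _ _ _ t}

/-- The smooth maps `f : ℝᵖ → ℝᵐ` such that for each compact `K` there are `λ` and `ρ > 0` with
`‖f‖_{K,ρ}^{M^λ} < ∞`. -/
def roumieuSubmodule : Submodule ℝ (Eu p → Eu m) where
  carrier := {f | ContDiff ℝ ∞ f ∧ ∀ K : Set (Eu p), IsCompact K → ∃ l : Λ, ∃ ρ : ℝ, 0 < ρ ∧
    ultraNorm (𝔐.seq l) ρ K (fun k => iteratedFDeriv ℝ k f) < ⊤}
  zero_mem' := ⟨contDiff_const, fun K _ => ⟨⟨_, 𝔐.nonempty.some_mem⟩, 1, one_pos, by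
    rw [ultraNorm_zero]
    · exact ENNReal.zero_lt_top
    · intro x _ k
      exact congrFun iteratedFDeriv_fun_zero x⟩⟩
  add_mem' := by
    rintro f g ⟨hf, hf'⟩ ⟨hg, hg'⟩
    refine ⟨hf.add hg, fun K hK => ?_⟩
    obtain ⟨l, ρ, hρ, h⟩ := hf' K hK
    obtain ⟨l', ρ', hρ', h'⟩ := hg' K hK
    refine ⟨max l l', max ρ ρ', lt_max_of_lt_left hρ,
      lt_of_le_of_lt (ultraNorm_add_le _ _ _ ?_) (ENNReal.add_lt_top.2
      ⟨lt_of_le_of_lt (ultraNorm_mono (𝔐.pos l) (𝔐.mono _ _ (le_max_left _ _)) hρ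
        (le_max_left _ _) _ _) h,
      lt_of_le_of_lt (ultraNorm_mono (𝔐.pos l') (𝔐.mono _ _ (le_max_right _ _)) hρ'
        (le_max_right _ _) _ _) h'⟩)⟩
    intro x _ k
    exact iteratedFDeriv_add_apply (hf.of_le (mod_cast le_top)).contDiffAt
      (hg.of_le (mod_cast le_top)).contDiffAt
  smul_mem' := by
    rintro c f ⟨hf, hf'⟩
    refine ⟨hf.const_smul c, fun K hK => ?_⟩
    obtain ⟨l, ρ, hρ, h⟩ := hf' K hK
    refine ⟨l, ρ, hρ, lt_of_le_of_lt (ultraNorm_smul_le _ _ _ c ?_)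
      (ENNReal.mul_lt_top enorm_lt_top h)⟩
    intro x _ k
    exact iteratedFDeriv_const_smul_apply (hf.of_le (mod_cast le_top)).contDiffAt

/-- The Roumieu space `ℰ^{\{𝔐\}}(ℝᵖ, ℝᵐ)`; its topology is not that of pointwise convergence but
the one defined below. -/
def WeightMatrix.Roumieu : Type := roumieuSubmodule 𝔐 p m

noncomputable instance : AddCommGroup (𝔐.Roumieu p m) :=
  inferInstanceAs (AddCommGroup (roumieuSubmodule 𝔐 p m))

noncomputable instance : Module ℝ (𝔐.Roumieu p m) :=
  inferInstanceAs (Module ℝ (roumieuSubmodule 𝔐 p m))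

instance : CoeFun (𝔐.Roumieu p m) (fun _ => Eu p → Eu m) := ⟨Subtype.val⟩

variable {p m} in
/-- The restriction map from `ℰ^{\{𝔐\}}(ℝᵖ, ℝᵐ)` to `ℰ^{\{𝔐\}}(K, ℝᵐ)`, `K` the closed ball of
radius `n + 1`. -/
noncomputable def restrict (f : 𝔐.Roumieu p m) : 𝔐.RoumieuLocal p m n :=
  ⟨(ball p n).indicator (f : Eu p → Eu m), by
    obtain ⟨l, ρ, hρ, h⟩ := f.2.2 (ball p n) (isCompact_ball p n)
    have he : Set.EqOn ((ball p n).indicator (f : Eu p → Eu m)) f (ball p n) :=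
      Set.eqOn_indicator
    refine ⟨l, ρ, hρ, f.2.1.contDiffOn.congr he,
      fun x hx => Set.indicator_of_notMem hx _, lt_of_eq_of_lt (ultraNorm_congr _ _ _ ?_) h⟩
    intro x hx k
    exact (iteratedFDerivWithin_congr he hx k).trans (iteratedFDerivWithin_eq_iteratedFDeriv
      (uniqueDiffOn_ball p n) (f.2.1.of_le (mod_cast le_top)).contDiffAt hx)⟩

/-- The natural topology of `ℰ^{\{𝔐\}}(ℝᵖ, ℝᵐ)`: the projective limit topology over the exhausting
balls `K` of the inductive limits `ℰ^{\{𝔐\}}(K, ℝᵐ)`. -/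
noncomputable instance : TopologicalSpace (𝔐.Roumieu p m) :=
  ⨅ n : ℕ, TopologicalSpace.induced (restrict 𝔐 n) inferInstance

end Roumieu

end Ultra

namespace Ultra

/-! ### Faà di Bruno estimates -/

/-! By Faà di Bruno's formula, the `k`-th derivative of `f ∘ g` is a sum over partitions `π` of `k`
points. If `‖g‖ ≤ B` with radius `ρ` and `‖f‖ ≤ A` with radius `σ`, both for `M`, then the term of
`π` is at most `|π|! ∏ |b|! (σB)^|π|` (`b` the blocks of `π`) times `A ρ^k M°_k`. These weights sum
to at most `k! (2 + σB)^k`. Hence `M° k ≤ C τ^k N k` gives `‖f ∘ g‖ ≤ A C` for `N` with radius `(2 +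
σB) ρ τ` (`ultraNorm_comp_le`).

Continuity needs no estimate of differences. Derivatives of compositions converge uniformly on
compact sets, order by order, and a bounded family with this property converges in norm for every
strictly larger radius (`tendsto_ultraNorm_sub`): a geometric factor handles high orders, uniform
convergence the finitely many others. In the Beurling case all radii are available, so `ρ` and `σ`
can be chosen to meet any target radius.

In the Roumieu case the difficulty is the inductive limit topology, since composition is not linear
in `g`. A cofinal sequence in `Λ` makes the limit countable, and by an Arzelà–Ascoli argument the
balls of each step are compact in the next (`compactScale_localNorm`). For such a scale, a set open
in every step is open (`CompactScale.isOpen`), so continuity in `g` may be tested step by step.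
Moreover, a null sequence is null in a single step (`CompactScale.exists_tendsto`), which reduces
joint sequential continuity to the norm estimates. Everything passes to the projective limit by
restriction to balls. -/

theorem _root_.OrderedFinpartition.sum_partSize {k : ℕ} (c : OrderedFinpartition k) :
    ∑ i, c.partSize i = k := by
  have h := Fintype.card_congr c.equivSigma
  simpa using h

/-- The composition of `k` given by the sizes of the parts. -/
def _root_.OrderedFinpartition.toComposition {k : ℕ} (c : OrderedFinpartition k) :
    Composition k where
  blocks := List.ofFn c.partSize
  blocks_pos := by
    intro i hi
    obtain ⟨j, rfl⟩ := (List.mem_ofFn' _ _).1 hi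
    exact c.partSize_pos j
  blocks_sum := by rw [List.sum_ofFn, c.sum_partSize]

/-- The block sizes of a set partition form a composition of `k`, one of the competitors in the
maximum. For `k = 0` the empty partition contributes `M 0 = 1`. -/
theorem le_circ (M : ℕ → ℝ) (hM0 : M 0 = 1) {k : ℕ} (c : OrderedFinpartition k) :
    M c.length * ∏ i, M (c.partSize i) ≤ circ M k := by
  unfold circ
  split_ifs with hk
  · subst hk
    have hl : c.length = 0 := Nat.le_zero.1 c.length_le
    have : IsEmpty (Fin c.length) := by rw [hl]; infer_instance
    simp [hl, hM0]
  · refine le_trans (le_of_eq ?_) (Finset.le_sup' (f := fun c : Composition k =>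
      M c.length * ∏ i, M (c.blocksFun i)) (Finset.mem_univ c.toComposition))
    have hl : c.toComposition.length = c.length := by
      simp [Composition.length, OrderedFinpartition.toComposition]
    have h1 : ∏ i, M (c.toComposition.blocksFun i) =
        (c.toComposition.blocks.map M).prod := by
      rw [← c.toComposition.ofFn_blocksFun, List.map_ofFn, List.prod_ofFn]
      rfl
    rw [h1, hl]
    simp [OrderedFinpartition.toComposition, List.map_ofFn, List.prod_ofFn]

/-- The weight `|π|! ∏ |B|! s^|π|` of a partition `π` into blocks `B`. -/
noncomputable def partitionWeight (s : ℝ) {k : ℕ} (c : OrderedFinpartition k) : ℝ :=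
  c.length ! * (∏ i, (c.partSize i)! : ℕ) * s ^ c.length

/-- Induction on where a new point goes. With `l` blocks present, a new singleton multiplies the
weight by `(l + 1) s` and joining block `i` by its size plus one. Altogether the factor is `k + l +
(l + 1) s`, which is at most `(k + 1)(2 + s)` because `l ≤ k`. -/
theorem sum_partitionWeight_le {s : ℝ} (hs : 0 ≤ s) (k : ℕ) :
    ∑ c : OrderedFinpartition k, partitionWeight s c ≤ k ! * (2 + s) ^ k := by
  induction k with
  | zero =>
    have : Subsingleton (OrderedFinpartition 0) := inferInstance
    rw [Fintype.sum_subsingleton _ (OrderedFinpartition.atomic 0)]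
    simp [partitionWeight]
  | succ k ih =>
    rw [← (OrderedFinpartition.extendEquiv k).sum_comp, Fintype.sum_sigma]
    have key : ∀ c : OrderedFinpartition k,
        ∑ o : Option (Fin c.length),
          partitionWeight s (OrderedFinpartition.extendEquiv k ⟨c, o⟩) ≤
        partitionWeight s c * ((k + 1) * (2 + s)) := by
      intro c
      have hl : (c.length : ℝ) ≤ k := mod_cast c.length_le
      have hw : 0 ≤ partitionWeight s c := by unfold partitionWeight; positivity
      rw [Fintype.sum_option]
      have hnone : partitionWeight s (OrderedFinpartition.extendEquiv k ⟨c, none⟩) =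
          partitionWeight s c * ((c.length + 1) * s) := by
        change partitionWeight s c.extendLeft = _
        have : (∏ i, (c.extendLeft.partSize i)! : ℕ) = ∏ i, (c.partSize i)! := by
          change ∏ i : Fin (c.length + 1), _ = _
          rw [Fin.prod_univ_succ]
          simp [OrderedFinpartition.extendLeft]
        unfold partitionWeight
        rw [this, OrderedFinpartition.extendLeft_length, Nat.factorial_succ]
        push_cast
        ring
      have hsome : ∀ i, partitionWeight s (OrderedFinpartition.extendEquiv k ⟨c, some i⟩) =
          partitionWeight s c * (c.partSize i + 1) := by
        intro i
        change partitionWeight s (c.extendMiddle i) = _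
        have : (∏ j, ((c.extendMiddle i).partSize j)! : ℕ) =
            (c.partSize i + 1) * ∏ j, (c.partSize j)! := by
          change ∏ j : Fin c.length, (Function.update c.partSize i (c.partSize i + 1) j)! = _
          rw [← Finset.mul_prod_erase _ _ (Finset.mem_univ i),
            ← Finset.mul_prod_erase Finset.univ (fun j => (c.partSize j)!) (Finset.mem_univ i),
            Function.update_self, Nat.factorial_succ, mul_assoc]
          congr 2
          refine Finset.prod_congr rfl fun j hj => ?_
          rw [Function.update_of_ne (Finset.ne_of_mem_erase hj)]
        unfold partitionWeight
        rw [this]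
        change ((c.length)! : ℝ) * _ * s ^ c.length = _
        push_cast
        ring
      rw [hnone, Finset.sum_congr rfl fun i _ => hsome i, ← Finset.mul_sum, ← mul_add]
      refine mul_le_mul_of_nonneg_left ?_ hw
      have hsum : ∑ i, ((c.partSize i : ℝ) + 1) = k + c.length := by
        rw [Finset.sum_add_distrib]
        simp [← Nat.cast_sum, c.sum_partSize]
      rw [hsum]
      nlinarith
    refine (Finset.sum_le_sum fun c _ => key c).trans ?_
    rw [← Finset.sum_mul, Nat.factorial_succ]
    push_cast
    have : 0 ≤ ((k : ℝ) + 1) * (2 + s) := by positivity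
    exact (mul_le_mul_of_nonneg_right ih this).trans_eq (by ring)

/-! ### Uniform convergence on compact sets -/

/-- On a compact set, uniform convergence to a continuous limit amounts to convergence as index and
point move together. This joint form can be composed with a moving inner function. -/
theorem tendstoUniformlyOn_of_forall_tendsto_prod {ι E F : Type*} [TopologicalSpace E]
    [UniformSpace F] {l : Filter ι} {s : Set E}
    (hs : IsCompact s) {P : ι → E → F} {Q : E → F} (hQ : ContinuousOn Q s)
    (h : ∀ x ∈ s, Filter.Tendsto (fun y : ι × E => P y.1 y.2) (l ×ˢ 𝓝[s] x) (𝓝 (Q x))) :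
    TendstoUniformlyOn P Q l s := by
  rw [← tendstoLocallyUniformlyOn_iff_tendstoUniformlyOn_of_compact hs,
    tendstoLocallyUniformlyOn_iff_forall_tendsto]
  intro x hx
  exact ((((hQ x hx).tendsto.comp Filter.tendsto_snd).prodMk_nhds (h x hx))).mono_right
    (nhds_le_uniformity (Q x))

theorem tendsto_prod_of_tendstoUniformlyOn {ι E F : Type*} [TopologicalSpace E]
    [UniformSpace F] {l : Filter ι} {s : Set E}
    {P : ι → E → F} {Q : E → F} (hQ : ContinuousOn Q s)
    (h : TendstoUniformlyOn P Q l s) {x : E} (hx : x ∈ s) :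
    Filter.Tendsto (fun y : ι × E => P y.1 y.2) (l ×ˢ 𝓝[s] x) (𝓝 (Q x)) := by
  have h1 := tendstoLocallyUniformlyOn_iff_forall_tendsto.1 h.tendstoLocallyUniformlyOn x hx
  exact (((hQ x hx).tendsto.comp Filter.tendsto_snd)).congr_uniformity h1

/-! ### Derivatives of compositions: bounds and limits -/

section Calculus

variable {E F G : Type*} [NormedAddCommGroup E] [NormedSpace ℝ E]
  [NormedAddCommGroup F] [NormedSpace ℝ F] [NormedAddCommGroup G] [NormedSpace ℝ G]

theorem ultraNorm_le_iff {M : ℕ → ℝ} (hM : ∀ k, 0 < M k) {ρ : ℝ} (hρ : 0 < ρ) {K : Set E}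
    {P : ∀ k : ℕ, E → E [×k]→L[ℝ] F} {A : ℝ} (hA : 0 ≤ A) :
    ultraNorm M ρ K P ≤ ENNReal.ofReal A ↔
      ∀ x ∈ K, ∀ k, ‖P k x‖ ≤ A * (k ! * ρ ^ k * M k) := by
  simp only [ultraNorm, iSup_le_iff]
  refine forall₂_congr fun x _ => forall_congr' fun k => ?_
  have := hM k
  rw [ENNReal.ofReal_le_ofReal_iff hA, div_le_iff₀ (by positivity)]

theorem iteratedFDerivWithin_comp_eq_taylorComp {s : Set E} {t : Set F} (hs : UniqueDiffOn ℝ s)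
    (ht : UniqueDiffOn ℝ t) {g : E → F} {f : F → G} (hg : ContDiffOn ℝ ∞ g s)
    (hf : ContDiffOn ℝ ∞ f t) (h : Set.MapsTo g s t) {x : E} (hx : x ∈ s) (k : ℕ) :
    iteratedFDerivWithin ℝ k (f ∘ g) s x =
      (ftaylorSeriesWithin ℝ f t (g x)).taylorComp (ftaylorSeriesWithin ℝ g s x) k :=
  ((hf.ftaylorSeriesWithin ht).comp (hg.ftaylorSeriesWithin hs) h
    |>.eq_iteratedFDerivWithin_of_uniqueDiffOn (mod_cast le_top) hs hx).symm

/-- In the term of a partition the powers of `ρ` multiply to `ρ ^ k`, while `B` and `σ` each occur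
once per block. Hence the partition weight with `s = σ * B` factors out and only the product of
`M`-values is left for `circ`. -/
theorem norm_iteratedFDerivWithin_comp_le_circ {M : ℕ → ℝ} (hM : ∀ k, 0 < M k) (hM0 : M 0 = 1)
    {s : Set E} {t : Set F} (hs : UniqueDiffOn ℝ s)
    (ht : UniqueDiffOn ℝ t) {g : E → F} {f : F → G} (hg : ContDiffOn ℝ ∞ g s)
    (hf : ContDiffOn ℝ ∞ f t) (h : Set.MapsTo g s t) {A B ρ σ : ℝ} (hA : 0 ≤ A) (hB : 0 ≤ B)
    (hρ : 0 < ρ) (hσ : 0 < σ)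
    (hgB : ultraNorm M ρ s (fun k => iteratedFDerivWithin ℝ k g s) ≤ ENNReal.ofReal B)
    (hfA : ultraNorm M σ t (fun k => iteratedFDerivWithin ℝ k f t) ≤ ENNReal.ofReal A)
    {x : E} (hx : x ∈ s) (k : ℕ) :
    ‖iteratedFDerivWithin ℝ k (f ∘ g) s x‖ ≤
      A * (k ! * ((2 + σ * B) * ρ) ^ k * circ M k) := by
  rw [ultraNorm_le_iff hM hρ hB] at hgB
  rw [ultraNorm_le_iff hM hσ hA] at hfA
  rw [iteratedFDerivWithin_comp_eq_taylorComp hs ht hg hf h hx]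
  have hterm : ∀ c : OrderedFinpartition k,
      ‖(ftaylorSeriesWithin ℝ f t (g x)).compAlongOrderedFinpartition
        (ftaylorSeriesWithin ℝ g s x) c‖ ≤
      partitionWeight (σ * B) c * (A * ρ ^ k * circ M k) := by
    intro c
    refine (c.norm_compAlongOrderedFinpartition_le _ _).trans ?_
    have h1 : ‖ftaylorSeriesWithin ℝ f t (g x) c.length‖ ≤
        A * (c.length ! * σ ^ c.length * M c.length) := hfA (g x) (h hx) c.length
    have h2 : ∏ i, ‖ftaylorSeriesWithin ℝ g s x (c.partSize i)‖ ≤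
        ∏ i, (B * ((c.partSize i)! * ρ ^ c.partSize i * M (c.partSize i))) :=
      Finset.prod_le_prod (fun i _ => norm_nonneg _) fun i _ => hgB x hx _
    have h3 : ∏ i, (B * ((c.partSize i)! * ρ ^ c.partSize i * M (c.partSize i))) =
        B ^ c.length * (∏ i, (c.partSize i)! : ℕ) * ρ ^ k * ∏ i, M (c.partSize i) := by
      simp only [Finset.prod_mul_distrib, Finset.prod_const, Finset.card_univ, Fintype.card_fin,
        Finset.prod_pow_eq_pow_sum, c.sum_partSize]
      push_cast
      ring
    have hMl := hM c.length
    calc _ ≤ A * (c.length ! * σ ^ c.length * M c.length) *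
          (B ^ c.length * (∏ i, (c.partSize i)! : ℕ) * ρ ^ k * ∏ i, M (c.partSize i)) := by
          rw [← h3]
          exact mul_le_mul h1 h2 (Finset.prod_nonneg fun i _ => norm_nonneg _) (by positivity)
      _ = partitionWeight (σ * B) c *
          (A * ρ ^ k * (M c.length * ∏ i, M (c.partSize i))) := by
          unfold partitionWeight; rw [mul_pow]; ring
      _ ≤ _ := by
          have hw : 0 ≤ partitionWeight (σ * B) c := by unfold partitionWeight; positivity
          have := le_circ M hM0 c
          gcongr
  have hcirc : 0 ≤ circ M k :=
    le_trans (mul_nonneg (hM _).le (Finset.prod_nonneg fun i _ => (hM _).le))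
      (le_circ M hM0 (OrderedFinpartition.atomic k))
  calc _ ≤ ∑ c : OrderedFinpartition k, partitionWeight (σ * B) c * (A * ρ ^ k * circ M k) :=
        (norm_sum_le _ _).trans (Finset.sum_le_sum fun c _ => hterm c)
    _ ≤ k ! * (2 + σ * B) ^ k * (A * ρ ^ k * circ M k) := by
        rw [← Finset.sum_mul]
        exact mul_le_mul_of_nonneg_right (sum_partitionWeight_le (by positivity) k) (by positivity)
    _ = _ := by rw [mul_pow]; ring

theorem ultraNorm_comp_le {M N : ℕ → ℝ} (hM : ∀ k, 0 < M k) (hM0 : M 0 = 1)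
    (hN : ∀ k, 0 < N k) {C τ : ℝ} (hC : 0 < C) (hτ : 0 < τ)
    (hMN : ∀ k, circ M k ≤ C * τ ^ k * N k)
    {s : Set E} {t : Set F} (hs : UniqueDiffOn ℝ s)
    (ht : UniqueDiffOn ℝ t) {g : E → F} {f : F → G} (hg : ContDiffOn ℝ ∞ g s)
    (hf : ContDiffOn ℝ ∞ f t) (h : Set.MapsTo g s t) {A B ρ σ : ℝ} (hA : 0 ≤ A) (hB : 0 ≤ B)
    (hρ : 0 < ρ) (hσ : 0 < σ)
    (hgB : ultraNorm M ρ s (fun k => iteratedFDerivWithin ℝ k g s) ≤ ENNReal.ofReal B)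
    (hfA : ultraNorm M σ t (fun k => iteratedFDerivWithin ℝ k f t) ≤ ENNReal.ofReal A) :
    ultraNorm N ((2 + σ * B) * ρ * τ) s (fun k => iteratedFDerivWithin ℝ k (f ∘ g) s) ≤
      ENNReal.ofReal (A * C) := by
  rw [ultraNorm_le_iff hN (by positivity) (by positivity)]
  intro x hx k
  refine (norm_iteratedFDerivWithin_comp_le_circ hM hM0 hs ht hg hf h hA hB hρ hσ hgB hfA hx
    k).trans ?_
  calc _ ≤ A * (k ! * ((2 + σ * B) * ρ) ^ k * (C * τ ^ k * N k)) := by gcongr; exact hMN k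
    _ = _ := by rw [mul_pow _ τ]; ring

/-! ### Convergence -/

/-- Each derivative of the composition is a finite sum of continuous multilinear expressions in the
derivatives of `f` at `g x` and of `g` at `x`. In the joint form of uniform convergence, the moving
point `g a y` can be substituted into the derivatives of `f a`. -/
theorem tendstoUniformlyOn_iteratedFDerivWithin_comp {ι : Type*} {l : Filter ι}
    {s : Set E} {t : Set F} (hs : UniqueDiffOn ℝ s) (hsc : IsCompact s)
    (ht : UniqueDiffOn ℝ t) {g : ι → E → F} {f : ι → F → G} {g₀ : E → F} {f₀ : F → G}
    (hg : ∀ᶠ a in l, ContDiffOn ℝ ∞ (g a) s) (hf : ∀ᶠ a in l, ContDiffOn ℝ ∞ (f a) t)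
    (h : ∀ᶠ a in l, Set.MapsTo (g a) s t)
    (hg₀ : ContDiffOn ℝ ∞ g₀ s) (hf₀ : ContDiffOn ℝ ∞ f₀ t) (h₀ : Set.MapsTo g₀ s t)
    (hgl : ∀ k, TendstoUniformlyOn (fun a => iteratedFDerivWithin ℝ k (g a) s)
      (iteratedFDerivWithin ℝ k g₀ s) l s)
    (hfl : ∀ k, TendstoUniformlyOn (fun a => iteratedFDerivWithin ℝ k (f a) t)
      (iteratedFDerivWithin ℝ k f₀ t) l t) (k : ℕ) :
    TendstoUniformlyOn (fun a => iteratedFDerivWithin ℝ k (f a ∘ g a) s)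
      (iteratedFDerivWithin ℝ k (f₀ ∘ g₀) s) l s := by
  have hcg : ∀ k, ContinuousOn (iteratedFDerivWithin ℝ k g₀ s) s := fun k =>
    hg₀.continuousOn_iteratedFDerivWithin (mod_cast le_top) hs
  have hcf : ∀ k, ContinuousOn (iteratedFDerivWithin ℝ k f₀ t) t := fun k =>
    hf₀.continuousOn_iteratedFDerivWithin (mod_cast le_top) ht
  refine tendstoUniformlyOn_of_forall_tendsto_prod hsc
    ((hf₀.comp hg₀ h₀).continuousOn_iteratedFDerivWithin (mod_cast le_top) hs) fun x hx => ?_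
  have hev : ∀ᶠ y : ι × E in l ×ˢ 𝓝[s] x,
      (ftaylorSeriesWithin ℝ (f y.1) t (g y.1 y.2)).taylorComp
        (ftaylorSeriesWithin ℝ (g y.1) s y.2) k =
      iteratedFDerivWithin ℝ k (f y.1 ∘ g y.1) s y.2 := by
    filter_upwards [((hg.and hf).and h).prod_mk self_mem_nhdsWithin] with y hy
    exact (iteratedFDerivWithin_comp_eq_taylorComp hs ht hy.1.1.1 hy.1.1.2 hy.1.2 hy.2 k).symm
  refine Filter.Tendsto.congr' hev ?_
  rw [iteratedFDerivWithin_comp_eq_taylorComp hs ht hg₀ hf₀ h₀ hx]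
  have hgx : Filter.Tendsto (fun y : ι × E => g y.1 y.2) (l ×ˢ 𝓝[s] x) (𝓝 (g₀ x)) := by
    have h1 := tendsto_prod_of_tendstoUniformlyOn (hcg 0) (hgl 0) hx
    have h2 := ((continuousMultilinearCurryFin0 ℝ E F).continuous.tendsto _).comp h1
    simpa [Function.comp_def, iteratedFDerivWithin_zero_eq_comp] using h2
  have hgt : Filter.Tendsto (fun y : ι × E => (y.1, g y.1 y.2)) (l ×ˢ 𝓝[s] x)
      (l ×ˢ 𝓝[t] (g₀ x)) := by
    refine Filter.tendsto_fst.prodMk (tendsto_nhdsWithin_iff.2 ⟨hgx, ?_⟩)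
    filter_upwards [h.prod_mk self_mem_nhdsWithin] with y hy
    exact hy.1 hy.2
  refine tendsto_finsetSum _ fun c _ => ?_
  have hB := (c.compAlongOrderedFinpartitionL ℝ E F G).continuous_uncurry_of_multilinear
  refine (hB.tendsto (ftaylorSeriesWithin ℝ f₀ t (g₀ x) c.length,
    fun i => ftaylorSeriesWithin ℝ g₀ s x (c.partSize i))).comp
    (Filter.Tendsto.prodMk_nhds
      ((tendsto_prod_of_tendstoUniformlyOn (hcf c.length) (hfl c.length)
        (h₀ hx)).comp hgt)
      (tendsto_pi_nhds.2 fun i =>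
        tendsto_prod_of_tendstoUniformlyOn (hcg (c.partSize i)) (hgl (c.partSize i)) hx))

/-- A family which is bounded for `‖·‖_{K,ρ}^M` and all of whose derivatives converge uniformly
converges for `‖·‖_{K,ρ'}^M`, `ρ' > ρ`. -/
theorem tendsto_ultraNorm_sub {ι : Type*} {l : Filter ι} {M : ℕ → ℝ} (hM : ∀ k, 0 < M k)
    {ρ ρ' : ℝ} (hρ : 0 < ρ) (hρρ' : ρ < ρ') {K : Set E} {P : ι → ∀ k : ℕ, E → E [×k]→L[ℝ] F}
    {Q : ∀ k : ℕ, E → E [×k]→L[ℝ] F} {A : ℝ} (hA : 0 ≤ A)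
    (hP : ∀ᶠ a in l, ultraNorm M ρ K (P a) ≤ ENNReal.ofReal A)
    (hQ : ultraNorm M ρ K Q ≤ ENNReal.ofReal A)
    (h : ∀ k, TendstoUniformlyOn (fun a => P a k) (Q k) l K) :
    Filter.Tendsto (fun a => ultraNorm M ρ' K (fun k x => P a k x - Q k x)) l (𝓝 0) := by
  have hρ' : 0 < ρ' := hρ.trans hρρ'
  rw [ENNReal.tendsto_nhds_zero]
  intro ε hε
  obtain ⟨δ, hδ, hδε⟩ : ∃ δ : ℝ, 0 < δ ∧ ENNReal.ofReal δ ≤ ε := by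
    rcases eq_or_ne ε ⊤ with rfl | hε'
    · exact ⟨1, one_pos, le_top⟩
    · exact ⟨ε.toReal, ENNReal.toReal_pos hε.ne' hε', ENNReal.ofReal_toReal_le⟩
  rw [ultraNorm_le_iff hM hρ hA] at hQ
  -- From order `n` on, the two bounds by `A` suffice, since `ρ < ρ'` gains a geometric factor. Only
  -- finitely many orders then need uniform convergence.
  obtain ⟨n, hn⟩ : ∃ n : ℕ, ∀ k, n ≤ k → 2 * A * (ρ / ρ') ^ k ≤ δ := by
    have h1 : Filter.Tendsto (fun k : ℕ => 2 * A * (ρ / ρ') ^ k) Filter.atTop (𝓝 (2 * A * 0)) :=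
      (tendsto_pow_atTop_nhds_zero_of_lt_one (by positivity)
        ((div_lt_one hρ').2 hρρ')).const_mul _
    rw [mul_zero] at h1
    exact Filter.eventually_atTop.1 (h1.eventually_le_const hδ)
  have hlow : ∀ᶠ a in l, ∀ k ∈ Finset.range n, ∀ x ∈ K,
      ‖P a k x - Q k x‖ ≤ δ * (k ! * ρ' ^ k * M k) := by
    rw [Filter.eventually_all_finset]
    intro k _
    have := hM k
    filter_upwards [Metric.tendstoUniformlyOn_iff.1 (h k) (δ * (k ! * ρ' ^ k * M k))
      (by positivity)] with a ha x hx
    rw [← dist_eq_norm, dist_comm]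
    exact (ha x hx).le
  filter_upwards [hlow, hP] with a ha hPa
  refine le_trans ?_ hδε
  rw [ultraNorm_le_iff hM hρ hA] at hPa
  rw [ultraNorm_le_iff hM hρ' hδ.le]
  intro x hx k
  rcases lt_or_ge k n with hk | hk
  · exact ha k (Finset.mem_range.2 hk) x hx
  · have hMk := hM k
    calc ‖P a k x - Q k x‖ ≤ A * (k ! * ρ ^ k * M k) + A * (k ! * ρ ^ k * M k) :=
          (norm_sub_le _ _).trans (add_le_add (hPa x hx k) (hQ x hx k))
      _ = (2 * A * (ρ / ρ') ^ k) * (k ! * ρ' ^ k * M k) := by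
          rw [div_pow]; field_simp; ring
      _ ≤ _ := by gcongr; exact hn k hk

theorem tendstoUniformlyOn_of_tendsto_ultraNorm_sub {ι : Type*} {l : Filter ι} {M : ℕ → ℝ}
    (hM : ∀ k, 0 < M k) {ρ : ℝ} (hρ : 0 < ρ) {K : Set E} {P : ι → ∀ k : ℕ, E → E [×k]→L[ℝ] F}
    {Q : ∀ k : ℕ, E → E [×k]→L[ℝ] F}
    (h : Filter.Tendsto (fun a => ultraNorm M ρ K (fun k x => P a k x - Q k x)) l (𝓝 0)) (k : ℕ) :
    TendstoUniformlyOn (fun a => P a k) (Q k) l K := by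
  rw [Metric.tendstoUniformlyOn_iff]
  intro ε hε
  have hMk := hM k
  set D : ℝ := k ! * ρ ^ k * M k with hD
  have hDp : 0 < D := by positivity
  have h1 := (ENNReal.tendsto_nhds_zero.1 h) (ENNReal.ofReal (ε / (2 * D)))
    (by rw [gt_iff_lt, ENNReal.ofReal_pos]; positivity)
  filter_upwards [h1] with a ha x hx
  rw [ultraNorm_le_iff hM hρ (by positivity)] at ha
  rw [dist_comm, dist_eq_norm]
  refine (ha x hx k).trans_lt ?_
  rw [← hD]
  field_simp
  linarith

/-- Convergence of compositions, for the extended norms on compact sets. -/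
theorem tendsto_ultraNorm_comp_sub {ι : Type*} {l : Filter ι} {M N : ℕ → ℝ} (hM : ∀ k, 0 < M k)
    (hM0 : M 0 = 1) (hN : ∀ k, 0 < N k) {C τ : ℝ} (hC : 0 < C) (hτ : 0 < τ)
    (hMN : ∀ k, circ M k ≤ C * τ ^ k * N k)
    {s : Set E} {t : Set F} (hs : UniqueDiffOn ℝ s) (hsc : IsCompact s)
    (ht : UniqueDiffOn ℝ t) {g : ι → E → F} {f : ι → F → G} {g₀ : E → F} {f₀ : F → G}
    (hg : ∀ᶠ a in l, ContDiffOn ℝ ∞ (g a) s) (hf : ∀ᶠ a in l, ContDiffOn ℝ ∞ (f a) t)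
    (h : ∀ᶠ a in l, Set.MapsTo (g a) s t)
    (hg₀ : ContDiffOn ℝ ∞ g₀ s) (hf₀ : ContDiffOn ℝ ∞ f₀ t) (h₀ : Set.MapsTo g₀ s t)
    {A B ρ σ ρ' : ℝ} (hA : 0 ≤ A) (hB : 0 ≤ B) (hρ : 0 < ρ) (hσ : 0 < σ)
    (hρ' : (2 + σ * B) * ρ * τ < ρ')
    (hgB : ∀ᶠ a in l,
      ultraNorm M ρ s (fun k => iteratedFDerivWithin ℝ k (g a) s) ≤ ENNReal.ofReal B)
    (hfA : ∀ᶠ a in l,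
      ultraNorm M σ t (fun k => iteratedFDerivWithin ℝ k (f a) t) ≤ ENNReal.ofReal A)
    (hgB₀ : ultraNorm M ρ s (fun k => iteratedFDerivWithin ℝ k g₀ s) ≤ ENNReal.ofReal B)
    (hfA₀ : ultraNorm M σ t (fun k => iteratedFDerivWithin ℝ k f₀ t) ≤ ENNReal.ofReal A)
    (hgl : ∀ k, TendstoUniformlyOn (fun a => iteratedFDerivWithin ℝ k (g a) s)
      (iteratedFDerivWithin ℝ k g₀ s) l s)
    (hfl : ∀ k, TendstoUniformlyOn (fun a => iteratedFDerivWithin ℝ k (f a) t)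
      (iteratedFDerivWithin ℝ k f₀ t) l t) :
    Filter.Tendsto (fun a => ultraNorm N ρ' s (fun k x =>
      iteratedFDerivWithin ℝ k (f a ∘ g a) s x - iteratedFDerivWithin ℝ k (f₀ ∘ g₀) s x))
      l (𝓝 0) := by
  refine tendsto_ultraNorm_sub hN (ρ := (2 + σ * B) * ρ * τ) (by positivity) hρ'
    (A := A * C) (by positivity) ?_
    (ultraNorm_comp_le hM hM0 hN hC hτ hMN hs ht hg₀ hf₀ h₀ hA hB hρ hσ hgB₀ hfA₀)
    (tendstoUniformlyOn_iteratedFDerivWithin_comp hs hsc ht hg hf h hg₀ hf₀ h₀ hgl hfl)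
  filter_upwards [hg, hf, h, hgB, hfA] with a h1 h2 h3 h4 h5
  exact ultraNorm_comp_le hM hM0 hN hC hτ hMN hs ht h1 h2 h3 hA hB hρ hσ h4 h5

end Calculus


/-! ### Countable inductive limits with compact linking maps -/

section Silva

open Filter
open scoped NNReal Pointwise

variable {E : Type*} [AddCommGroup E] [Module ℝ E]

/-- A decreasing sequence of extended norms on a vector space `E` exhausting `E`, such that the
balls of `N i` are compact for `N (i + 1)`. -/
structure CompactScale (N : ℕ → E → ℝ≥0∞) : Prop where
  zero : ∀ i, N i 0 = 0
  add_le : ∀ i x y, N i (x + y) ≤ N i x + N i y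
  smul_le : ∀ i (c : ℝ) x, N i (c • x) ≤ ‖c‖ₑ * N i x
  antitone : Antitone N
  exists_lt_top : ∀ x, ∃ i, N i x < ⊤
  eq_zero : ∀ i x, N i x = 0 → x = 0
  compact : ∀ i (R : ℝ≥0) (c : ℕ → E), (∀ n, N i (c n) ≤ R) →
    ∃ x, N i x ≤ R ∧ Tendsto (fun n => N (i + 1) (c n - x)) (hyperfilter ℕ) (𝓝 0)

/-- `U` is open for each of the extended norms `N i`. -/
def ScaleOpen (N : ℕ → E → ℝ≥0∞) (U : Set E) : Prop :=
  ∀ x ∈ U, ∀ i, ∃ ε : ℝ≥0, 0 < ε ∧ ∀ y, N i (y - x) ≤ ε → y ∈ U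

variable {N : ℕ → E → ℝ≥0∞}

theorem CompactScale.neg (h : CompactScale N) (i : ℕ) (x : E) : N i (-x) = N i x := by
  have key : ∀ x, N i (-x) ≤ N i x := fun x => by simpa using h.smul_le i (-1) x
  exact le_antisymm (key x) (by simpa using key (-x))

theorem CompactScale.sub_comm (h : CompactScale N) (i : ℕ) (x y : E) :
    N i (x - y) = N i (y - x) := by rw [← h.neg, neg_sub]

theorem CompactScale.absConvex_closedBall (h : CompactScale N) (i : ℕ) (ε : ℝ≥0) :
    AbsConvex ℝ {x | N i x ≤ ε} := by
  refine ⟨balanced_iff_smul_mem.2 fun {a} ha x hx => ?_, fun x hx y hy a b ha hb hab => ?_⟩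
  · refine (h.smul_le i a x).trans ?_
    have : ‖a‖ₑ ≤ 1 := by rw [← ofReal_norm]; exact ENNReal.ofReal_le_one.2 ha
    exact (mul_le_mul' this hx).trans_eq (one_mul _)
  · have h1 : ∀ c : ℝ, 0 ≤ c → ‖c‖ₑ = ENNReal.ofReal c := fun c hc => Real.enorm_of_nonneg hc
    calc N i (a • x + b • y) ≤ ‖a‖ₑ * N i x + ‖b‖ₑ * N i y :=
          (h.add_le _ _ _).trans (add_le_add (h.smul_le _ _ _) (h.smul_le _ _ _))
      _ ≤ ENNReal.ofReal a * ε + ENNReal.ofReal b * ε := by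
          rw [h1 a ha, h1 b hb]
          exact add_le_add (mul_le_mul' le_rfl hx) (mul_le_mul' le_rfl hy)
      _ = ε := by rw [← add_mul, ← ENNReal.ofReal_add ha hb, hab]; simp

/-- Limits along one fixed nonprincipal ultrafilter replace the extraction of subsequences. -/
theorem tendsto_hyperfilter_of_le {u : ℕ → ℝ≥0∞} (h : ∀ n, u n ≤ ((n : ℝ≥0∞) + 1)⁻¹) :
    Tendsto u (hyperfilter ℕ) (𝓝 0) := by
  have h1 : Tendsto (fun n : ℕ => ((n : ℝ≥0∞) + 1)⁻¹) atTop (𝓝 0) := by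
    have := (tendsto_add_atTop_iff_nat 1).2 ENNReal.tendsto_inv_nat_nhds_zero
    simpa using this
  exact tendsto_of_tendsto_of_tendsto_of_le_of_le tendsto_const_nhds
    (h1.mono_left Nat.hyperfilter_le_atTop) (fun _ => zero_le) h

/-- In a compact scale, every set which is open at each step contains an absolutely convex set
containing balls of each step. -/
theorem CompactScale.exists_absConvex (h : CompactScale N) {U : Set E} (hU : ScaleOpen N U)
    (h0 : (0 : E) ∈ U) :
    ∃ V ⊆ U, AbsConvex ℝ V ∧ ∀ i, ∃ ε : ℝ≥0, 0 < ε ∧ ∀ x, N i x ≤ ε → x ∈ V := by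
  -- Invariant of the construction: `C` is absolutely convex, inside `U`, and compact for `N i`.
  let Q : ℕ → Set E → Prop := fun i C => C ⊆ U ∧ AbsConvex ℝ C ∧
    ∀ c : ℕ → E, (∀ n, c n ∈ C) →
      ∃ x ∈ C, Tendsto (fun n => N i (c n - x)) (hyperfilter ℕ) (𝓝 0)
  have step : ∀ i C, Q i C → ∃ C', Q (i + 1) C' ∧ C ⊆ C' ∧
      ((0 : E) ∈ C → ∃ ε : ℝ≥0, 0 < ε ∧ ∀ x, N i x ≤ ε → x ∈ C') := by
    rintro i C ⟨hCU, hCa, hCc⟩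
    -- A compact subset of `U` keeps a positive distance from the complement. Otherwise points `c n
    -- + y n` outside `U` with `y n` tending to zero would have an `N i`-limit in `C`, around which
    -- `U` contains an `N i`-ball.
    obtain ⟨ε, hε, hεU⟩ : ∃ ε : ℝ≥0, 0 < ε ∧ C + {x | N i x ≤ ε} ⊆ U := by
      by_contra hcon
      push Not at hcon
      have : ∀ n : ℕ, ∃ c ∈ C, ∃ y, N i y ≤ ((n : ℝ≥0∞) + 1)⁻¹ ∧ c + y ∉ U := by
        intro n
        have := hcon ((n + 1 : ℝ≥0)⁻¹) (by positivity)
        obtain ⟨z, ⟨c, hc, y, hy, rfl⟩, hz⟩ := Set.not_subset.1 this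
        refine ⟨c, hc, y, le_trans hy ?_, hz⟩
        rw [ENNReal.coe_inv (by positivity)]
        simp
      choose c hc y hy hcy using this
      obtain ⟨x, hx, hlim⟩ := hCc c hc
      obtain ⟨ε, hε, hεU⟩ := hU x (hCU hx) i
      have hlim2 := hlim.add (tendsto_hyperfilter_of_le hy)
      rw [add_zero] at hlim2
      obtain ⟨n, hn⟩ := (hlim2.eventually_le_const (u := (ε : ℝ≥0∞)) (by simpa using hε)).exists
      refine hcy n (hεU _ (le_trans ?_ hn))
      rw [add_sub_right_comm]
      exact h.add_le _ _ _
    -- The added ball of `N i` is compact only for `N (i + 1)`, hence the shift of the index in `Q`.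
    refine ⟨C + {x | N i x ≤ ε}, ⟨hεU, ?_, ?_⟩, ?_, fun h0C => ⟨ε, hε, fun x hx => ?_⟩⟩
    · exact ⟨hCa.1.add (h.absConvex_closedBall i ε).1, hCa.2.add (h.absConvex_closedBall i ε).2⟩
    · intro z hz
      choose c hc y hy hcy using hz
      obtain ⟨x, hx, hxl⟩ := hCc c hc
      obtain ⟨w, hw, hwl⟩ := h.compact i ε y hy
      refine ⟨x + w, Set.add_mem_add hx hw, ?_⟩
      have hl := hxl.add hwl
      rw [add_zero] at hl
      refine tendsto_of_tendsto_of_tendsto_of_le_of_le tendsto_const_nhds hl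
        (fun _ => zero_le) fun n => ?_
      have : z n - (x + w) = (c n - x) + (y n - w) := by rw [← hcy]; simp only; abel
      simp only [this]
      exact (h.add_le _ _ _).trans (add_le_add (h.antitone (Nat.le_succ i) _) le_rfl)
    · intro x hx
      exact ⟨x, hx, 0, by simp [h.zero], add_zero x⟩
    · exact ⟨0, h0C, x, hx, zero_add x⟩
  choose! next hnext hsub hball using step
  -- Starting from `{0}`, stage `i` adds a small ball of `N i`; the increasing union is the required
  -- set.
  let C : ℕ → Set E := fun n => Nat.rec {0} (fun i C => next i C) n
  have hC : ∀ i, Q i (C i) := by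
    intro i
    induction i with
    | zero =>
      refine ⟨by simpa [C] using h0, ⟨?_, convex_singleton 0⟩, fun c hc => ⟨0, rfl, ?_⟩⟩
      · exact balanced_zero
      · have : ∀ n, c n = 0 := hc
        simp [this, h.zero]
    | succ i ih => exact hnext i _ ih
  have hmono : Monotone C := monotone_nat_of_le_succ fun i => hsub i _ (hC i)
  have h0C : ∀ i, (0 : E) ∈ C i := fun i => hmono (Nat.zero_le i) (Set.mem_singleton (0 : E))
  refine ⟨⋃ i, C i, Set.iUnion_subset fun i => (hC i).1,
    ⟨balanced_iUnion fun i => (hC i).2.1.1, ?_⟩, fun i => ?_⟩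
  · exact (hmono.directed_le).convex_iUnion fun {i} => (hC i).2.1.2
  · obtain ⟨ε, hε, hx⟩ := hball i _ (hC i) (h0C i)
    exact ⟨ε, hε, fun x hxi => Set.mem_iUnion.2 ⟨i + 1, hx x hxi⟩⟩

/-- The topology of `E` is at least as fine as the locally convex inductive limit topology given
by the extended norms `N i`: an absolutely convex set containing a ball of each `N i` is a
neighbourhood of zero. -/
def CompactScale.FineTopology (N : ℕ → E → ℝ≥0∞) [TopologicalSpace E] : Prop :=
  ∀ V : Set E, AbsConvex ℝ V →
    (∀ i, ∃ ε : ℝ≥0, 0 < ε ∧ ∀ x, N i x ≤ ε → x ∈ V) → V ∈ 𝓝 (0 : E)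

variable [TopologicalSpace E] [IsTopologicalAddGroup E]

/-- After translation to zero, `exists_absConvex` turns openness at each step into a convex
neighbourhood. This is what lets nonlinear maps be tested for continuity step by step. -/
theorem CompactScale.isOpen (h : CompactScale N) (ht : CompactScale.FineTopology N) {U : Set E}
    (hU : ScaleOpen N U) : IsOpen U := by
  rw [isOpen_iff_mem_nhds]
  intro x hx
  have hU' : ScaleOpen N {z | x + z ∈ U} := by
    intro z hz i
    obtain ⟨ε, hε, hεU⟩ := hU (x + z) hz i
    exact ⟨ε, hε, fun y hy => hεU _ (by simpa using hy)⟩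
  obtain ⟨V, hVU, hV, hVN⟩ := h.exists_absConvex hU' (by simpa using hx)
  have hV0 := Filter.mem_of_superset (ht V hV hVN) hVU
  have h1 : Tendsto (fun y => y - x) (𝓝 x) (𝓝 0) := by
    have : Continuous fun y : E => y - x := by fun_prop
    simpa using this.tendsto x
  filter_upwards [h1 hV0] with y hy
  simpa using hy

/-- A null sequence in the inductive limit of a compact scale is bounded in some step. -/
theorem CompactScale.exists_bounded (h : CompactScale N) (ht : CompactScale.FineTopology N)
    {u : ℕ → E} (hu : Tendsto u atTop (𝓝 0)) : ∃ m : ℕ, ∀ n, N m (u n) ≤ m := by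
  by_contra hcon
  push Not at hcon
  -- an unbounded subsequence is closed and discrete
  have hfreq : ∀ i k : ℕ, ∃ n ≥ k, (i : ℝ≥0∞) < N i (u n) := by
    intro i k
    by_contra hk
    push Not at hk
    have hfin : ∀ n : ℕ, ∃ m : ℕ, N m (u n) ≤ m := by
      intro n
      obtain ⟨j, hj⟩ := h.exists_lt_top (u n)
      obtain ⟨m, hm⟩ := ENNReal.exists_nat_gt hj.ne
      exact ⟨max j m, (h.antitone (le_max_left j m) _).trans
        (hm.le.trans (by exact_mod_cast le_max_right j m))⟩
    choose m hm using hfin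
    have hmono : ∀ {a b : ℕ} {x : E}, a ≤ b → N a x ≤ a → N b x ≤ b := fun hab hx =>
      (h.antitone hab _).trans (hx.trans (by exact_mod_cast hab))
    obtain ⟨n, hn⟩ := hcon (max i ((Finset.range k).sup m))
    refine hn.not_ge ?_
    rcases lt_or_ge n k with hnk | hnk
    · exact hmono ((Finset.le_sup (f := m) (Finset.mem_range.2 hnk)).trans (le_max_right _ _))
        (hm n)
    · exact hmono (le_max_left _ _) (hk n hnk)
  choose ψ hψ hψN using hfreq
  let y : ℕ → E := fun i => u (ψ i i)
  have hy : ∀ i : ℕ, (i : ℝ≥0∞) < N i (y i) := fun i => hψN i i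
  have hopen : IsOpen (Set.range y)ᶜ := by
    refine h.isOpen ht fun x hx j => ?_
    obtain ⟨j', hj'⟩ := h.exists_lt_top x
    -- `N J x` is finite and `N J ≤ N j`, so a ball of `N j` may be treated with `N J`. Within
    -- distance one of `x`, the norm `N J` stays below `m₀`, which excludes `y i` for `i ≥ m`; the
    -- remaining `y i` are finitely many and at positive distance.
    set J := max j j'
    have hJ : N J x < ⊤ := (h.antitone (le_max_right j j') x).trans_lt hj'
    obtain ⟨m₀, hm₀⟩ := ENNReal.exists_nat_gt (ENNReal.add_lt_top.2 ⟨hJ, ENNReal.one_lt_top⟩).ne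
    set m := max m₀ J
    have hne : ∀ i, N J (y i - x) ≠ 0 := fun i hi =>
      hx ⟨i, sub_eq_zero.1 (h.eq_zero J _ hi)⟩
    obtain ⟨δ, hδ, hδy⟩ : ∃ δ : ℝ≥0, 0 < δ ∧ ∀ i ∈ Finset.range m, (δ : ℝ≥0∞) < N J (y i - x) := by
      have : ∀ᶠ δ : ℝ≥0 in 𝓝[>] 0, ∀ i ∈ Finset.range m, (δ : ℝ≥0∞) < N J (y i - x) := by
        rw [Filter.eventually_all_finset]
        intro i _
        have hc : Tendsto (fun δ : ℝ≥0 => (δ : ℝ≥0∞)) (𝓝[>] 0) (𝓝 0) := by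
          have := (ENNReal.continuous_coe.tendsto (0 : ℝ≥0)).mono_left
            (nhdsWithin_le_nhds (s := Set.Ioi 0))
          simpa using this
        exact hc.eventually_lt_const (pos_iff_ne_zero.2 (hne i))
      obtain ⟨δ, h1, h2⟩ := (this.and self_mem_nhdsWithin).exists
      exact ⟨δ, h2, h1⟩
    refine ⟨min δ 1, lt_min hδ one_pos, ?_⟩
    rintro _ hz ⟨i, rfl⟩
    have hz' : N J (y i - x) ≤ (min δ 1 : ℝ≥0) := (h.antitone (le_max_left j j') _).trans hz
    rcases lt_or_ge i m with him | him
    · exact (hδy i (Finset.mem_range.2 him)).not_ge (hz'.trans (by exact_mod_cast min_le_left _ _))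
    · have h1 : N J (y i) ≤ 1 + N J x := by
        calc N J (y i) = N J ((y i - x) + x) := by rw [sub_add_cancel]
          _ ≤ _ := (h.add_le _ _ _).trans (add_le_add
            (hz'.trans (by exact_mod_cast min_le_right _ _)) le_rfl)
      refine (hy i).not_ge ((h.antitone ((le_max_right m₀ J).trans him) _).trans ?_)
      refine h1.trans ?_
      rw [add_comm]
      exact hm₀.le.trans (by exact_mod_cast (le_max_left m₀ J).trans him)
  have h0 : (0 : E) ∈ (Set.range y)ᶜ := by
    rintro ⟨i, hi⟩
    have := hy i
    rw [hi, h.zero] at this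
    exact not_lt_zero this
  obtain ⟨n, hn⟩ := eventually_atTop.1 (hu (hopen.mem_nhds h0))
  exact hn (ψ n n) (hψ n n) ⟨n, rfl⟩

/-- A null sequence in the inductive limit of a compact scale is a null sequence in some step. -/
theorem CompactScale.exists_tendsto (h : CompactScale N) (ht : CompactScale.FineTopology N)
    {u : ℕ → E} (hu : Tendsto u atTop (𝓝 0)) :
    ∃ m : ℕ, Tendsto (fun n => N m (u n)) atTop (𝓝 0) := by
  obtain ⟨m, hm⟩ := h.exists_bounded ht hu
  refine ⟨m + 1, ENNReal.tendsto_nhds_zero.2 fun ε hε => ?_⟩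
  -- The complement is closed in each step: a sequence in it that converges to `x` for `N j` also
  -- has an ultrafilter limit for `N (m + 1)`, by compactness of the `N m`-ball. The two limits
  -- agree, and both inequalities survive.
  have hopen : IsOpen {x | ¬ (N m x ≤ m ∧ ε ≤ N (m + 1) x)} := by
    refine h.isOpen ht fun x hx j => ?_
    by_contra hcon
    push Not at hcon
    have : ∀ n : ℕ, ∃ y, N j (y - x) ≤ ((n : ℝ≥0∞) + 1)⁻¹ ∧ N m y ≤ m ∧ ε ≤ N (m + 1) y := by
      intro n
      obtain ⟨y, hy, hy'⟩ := hcon ((n + 1 : ℝ≥0)⁻¹) (by positivity)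
      rw [Set.mem_ofPred_eq, Classical.not_imp, not_lt] at hy'
      refine ⟨y, hy.trans ?_, hy'⟩
      rw [ENNReal.coe_inv (by positivity)]
      simp
    choose y hyx hym hyε using this
    obtain ⟨z, hz, hyz⟩ := h.compact m (m : ℝ≥0) y (by simpa using hym)
    have hzx : z = x := by
      refine sub_eq_zero.1 (h.eq_zero (max (m + 1) j) _ (le_antisymm ?_ zero_le))
      have h1 := hyz.add (tendsto_hyperfilter_of_le hyx)
      rw [add_zero] at h1
      refine ge_of_tendsto' h1 fun n => ?_
      calc N (max (m + 1) j) (z - x) = N (max (m + 1) j) ((z - y n) + (y n - x)) := by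
            rw [sub_add_sub_cancel]
        _ ≤ _ := (h.add_le _ _ _).trans (add_le_add
            ((h.antitone (le_max_left _ _) _).trans_eq (h.sub_comm _ _ _))
            (h.antitone (le_max_right _ _) _))
    subst hzx
    refine hx ⟨by simpa using hz, ?_⟩
    have h1 := hyz.add_const (N (m + 1) z)
    rw [zero_add] at h1
    refine ge_of_tendsto' h1 fun n => (hyε n).trans ?_
    calc N (m + 1) (y n) = N (m + 1) ((y n - z) + z) := by rw [sub_add_cancel]
      _ ≤ _ := h.add_le _ _ _
  have h0 : (0 : E) ∈ {x | ¬ (N m x ≤ m ∧ ε ≤ N (m + 1) x)} := by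
    simpa [h.zero] using hε
  filter_upwards [hu (hopen.mem_nhds h0)] with n hn
  by_contra hc
  exact hn ⟨hm n, (not_le.1 hc).le⟩

end Silva


/-! ### Compactness of the balls of `‖·‖_{K,ρ}^M` -/

section Compactness

variable {E F : Type*} [NormedAddCommGroup E] [NormedSpace ℝ E]
  [NormedAddCommGroup F] [NormedSpace ℝ F]

theorem finiteDimensional_continuousMultilinearMap [FiniteDimensional ℝ E] [FiniteDimensional ℝ F]
    (k : ℕ) : FiniteDimensional ℝ (E [×k]→L[ℝ] F) :=
  Module.Finite.of_injective
    ({ toFun := ContinuousMultilinearMap.toMultilinearMap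
       map_add' := fun _ _ => rfl
       map_smul' := fun _ _ => rfl } :
      (E [×k]→L[ℝ] F) →ₗ[ℝ] MultilinearMap ℝ (fun _ : Fin k => E) F)
    ContinuousMultilinearMap.toMultilinearMap_injective

/-- The mean value inequality on `K ∩ closedBall x ‖y - x‖`, where `v'` differs from `v' x` by at
most `L * ‖y - x‖`. Such a quantitative remainder bound survives pointwise limits, unlike
differentiability. -/
theorem norm_image_sub_sub_le_sq {K : Set E} (hK : Convex ℝ K) {v : E → F} {v' : E → E →L[ℝ] F}
    {L : ℝ} (hv : ∀ x ∈ K, HasFDerivWithinAt v (v' x) K x)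
    (hL : ∀ x ∈ K, ∀ y ∈ K, ‖v' y - v' x‖ ≤ L * ‖y - x‖) {x y : E} (hx : x ∈ K) (hy : y ∈ K)
    (hL0 : 0 ≤ L) :
    ‖v y - v x - v' x (y - x)‖ ≤ L * ‖y - x‖ * ‖y - x‖ := by
  have hconv : Convex ℝ (K ∩ Metric.closedBall x ‖y - x‖) := hK.inter (convex_closedBall _ _)
  refine hconv.norm_image_sub_le_of_norm_hasFDerivWithin_le' (f' := v')
    (fun z hz => (hv z hz.1).mono Set.inter_subset_left) (fun z hz => ?_)
    ⟨hx, Metric.mem_closedBall_self (norm_nonneg _)⟩ ⟨hy, ?_⟩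
  · refine (hL x hx z hz.1).trans ?_
    gcongr
    simpa [dist_eq_norm] using hz.2
  · simp [dist_eq_norm]

/-- Every ultrafilter on a family of functions bounded for `‖·‖_{K,ρ}^M` converges, uniformly
together with all derivatives. -/
theorem exists_tendstoUniformlyOn_iteratedFDerivWithin [FiniteDimensional ℝ E]
    [FiniteDimensional ℝ F] {ι : Type*} (l : Ultrafilter ι) {M : ℕ → ℝ} (hM : ∀ k, 0 < M k)
    {ρ A : ℝ} (hρ : 0 < ρ) (hA : 0 ≤ A) {K : Set E} (hK : Convex ℝ K) (hKc : IsCompact K)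
    (hKu : UniqueDiffOn ℝ K) {c : ι → E → F} (hc : ∀ a, ContDiffOn ℝ ∞ (c a) K)
    (hcA : ∀ a, ultraNorm M ρ K (fun k => iteratedFDerivWithin ℝ k (c a) K) ≤
      ENNReal.ofReal A) :
    ∃ h : E → F, ContDiffOn ℝ ∞ h K ∧ (∀ x ∉ K, h x = 0) ∧
      ultraNorm M ρ K (fun k => iteratedFDerivWithin ℝ k h K) ≤ ENNReal.ofReal A ∧
      ∀ k, TendstoUniformlyOn (fun a => iteratedFDerivWithin ℝ k (c a) K)
        (iteratedFDerivWithin ℝ k h K) l K := by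
  classical
  let b : ℕ → ℝ := fun k => A * (k ! * ρ ^ k * M k)
  have hb : ∀ k, 0 ≤ b k := fun k => by have := hM k; positivity
  have hbd : ∀ a, ∀ x ∈ K, ∀ k, ‖iteratedFDerivWithin ℝ k (c a) K x‖ ≤ b k := fun a =>
    (ultraNorm_le_iff hM hρ hA).1 (hcA a)
  have hderiv : ∀ a k, ∀ x ∈ K, HasFDerivWithinAt (iteratedFDerivWithin ℝ k (c a) K)
      (iteratedFDerivWithin ℝ (k + 1) (c a) K x).curryLeft K x := fun a k =>
    ((hc a).ftaylorSeriesWithin hKu).fderivWithin k (mod_cast WithTop.coe_lt_top k)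
  -- The bound on order `k + 1` makes the derivatives of order `k` equi-Lipschitz.
  have hlip : ∀ a k, ∀ x ∈ K, ∀ y ∈ K,
      ‖iteratedFDerivWithin ℝ k (c a) K y - iteratedFDerivWithin ℝ k (c a) K x‖ ≤
        b (k + 1) * ‖y - x‖ := fun a k x hx y hy =>
    hK.norm_image_sub_le_of_norm_hasFDerivWithin_le (hderiv a k)
      (fun z hz => by rw [ContinuousMultilinearMap.curryLeft_norm]; exact hbd a z hz _) hx hy
  have hlim : ∀ k x, ∃ q : E [×k]→L[ℝ] F, x ∈ K →
      Filter.Tendsto (fun a => iteratedFDerivWithin ℝ k (c a) K x) l (𝓝 q) := by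
    intro k x
    by_cases hx : x ∈ K
    · have := finiteDimensional_continuousMultilinearMap (E := E) (F := F) k
      have := FiniteDimensional.proper ℝ (E [×k]→L[ℝ] F)
      obtain ⟨q, -, hq⟩ := (isCompact_closedBall (0 : E [×k]→L[ℝ] F) (b k)).ultrafilter_le_nhds'
        (l.map (fun a => iteratedFDerivWithin ℝ k (c a) K x))
        (Ultrafilter.mem_map.2 (Filter.univ_mem' fun a => by simpa using hbd a x hx k))
      exact ⟨q, fun _ => hq⟩
    · exact ⟨0, fun h => absurd h hx⟩
  choose Q hQ using hlim
  have hQb : ∀ x ∈ K, ∀ k, ‖Q k x‖ ≤ b k := fun x hx k =>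
    le_of_tendsto (hQ k x hx).norm (Filter.Eventually.of_forall fun a => hbd a x hx k)
  have hQlip : ∀ k, ∀ x ∈ K, ∀ y ∈ K, ‖Q k y - Q k x‖ ≤ b (k + 1) * ‖y - x‖ :=
    fun k x hx y hy => le_of_tendsto ((hQ k y hy).sub (hQ k x hx)).norm
      (Filter.Eventually.of_forall fun a => hlip a k x hx y hy)
  have hQcont : ∀ k, ContinuousOn (Q k) K := fun k =>
    (LipschitzOnWith.of_dist_le_mul (K := ⟨b (k + 1), hb _⟩) fun y hy x hx => by
      rw [dist_eq_norm, dist_eq_norm]; exact hQlip k x hx y hy).continuousOn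
  -- The uniform Taylor remainder passes to the limit and shows that `Q (k + 1)` is the derivative
  -- of `Q k`.
  have hQtaylor : ∀ k, ∀ x ∈ K, ∀ y ∈ K,
      ‖Q k y - Q k x - (Q (k + 1) x).curryLeft (y - x)‖ ≤
        b (k + 2) * ‖y - x‖ * ‖y - x‖ := by
    intro k x hx y hy
    have h1 : Filter.Tendsto
        (fun a => (iteratedFDerivWithin ℝ (k + 1) (c a) K x).curryLeft (y - x)) l
        (𝓝 ((Q (k + 1) x).curryLeft (y - x))) :=
      (((continuousMultilinearCurryLeftEquiv ℝ (fun _ : Fin (k + 1) => E) F).continuous.clm_apply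
        continuous_const).tendsto _).comp (hQ (k + 1) x hx)
    refine le_of_tendsto (((hQ k y hy).sub (hQ k x hx)).sub h1).norm
      (Filter.Eventually.of_forall fun a => ?_)
    refine norm_image_sub_sub_le_sq hK (hderiv a k) (fun x hx y hy => ?_) hx hy (hb _)
    have h2 : (iteratedFDerivWithin ℝ (k + 1) (c a) K y).curryLeft -
        (iteratedFDerivWithin ℝ (k + 1) (c a) K x).curryLeft =
        (iteratedFDerivWithin ℝ (k + 1) (c a) K y -
          iteratedFDerivWithin ℝ (k + 1) (c a) K x).curryLeft := rfl
    rw [h2, ContinuousMultilinearMap.curryLeft_norm]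
    exact hlip a (k + 1) x hx y hy
  let h : E → F := fun x => if x ∈ K then (Q 0 x).curry0 else 0
  have hT : HasFTaylorSeriesUpToOn ∞ h (fun x k => Q k x) K := by
    refine ⟨fun x hx => by simp [h, hx], fun k _ x hx => ?_, fun k _ => hQcont k⟩
    refine .of_isLittleO (Asymptotics.isLittleO_iff.2 fun ε hε => ?_)
    have h1 : Filter.Tendsto (fun y => b (k + 2) * ‖y - x‖) (𝓝[K] x) (𝓝 0) := by
      have : Continuous fun y => b (k + 2) * ‖y - x‖ := by fun_prop
      simpa using (this.tendsto x).mono_left nhdsWithin_le_nhds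
    filter_upwards [h1.eventually_le_const hε, self_mem_nhdsWithin] with y hy hyK
    exact (hQtaylor k x hx y hyK).trans (by gcongr)
  have hC : ContDiffOn ℝ ∞ h K := contDiffOn_infty.2 fun n =>
    (hT.of_le (mod_cast le_top)).contDiffOn
  have hQeq : ∀ x ∈ K, ∀ k, iteratedFDerivWithin ℝ k h K x = Q k x := fun x hx k =>
    (hT.eq_iteratedFDerivWithin_of_uniqueDiffOn (mod_cast le_top) hKu hx).symm
  refine ⟨h, hC, fun x hx => by simp [h, hx], ?_, fun k => ?_⟩
  · rw [ultraNorm_le_iff hM hρ hA]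
    intro x hx k
    rw [hQeq x hx k]
    exact hQb x hx k
  · refine TendstoUniformlyOn.congr_right ?_ fun x hx => (hQeq x hx k).symm
    refine tendstoUniformlyOn_of_forall_tendsto_prod hKc (hQcont k) fun x hx => ?_
    have h1 : Filter.Tendsto (fun y : ι × E => iteratedFDerivWithin ℝ k (c y.1) K x)
        ((l : Filter ι) ×ˢ 𝓝[K] x) (𝓝 (Q k x)) := (hQ k x hx).comp Filter.tendsto_fst
    have h2 : Filter.Tendsto (fun y : ι × E => b (k + 1) * ‖y.2 - x‖)
        ((l : Filter ι) ×ˢ 𝓝[K] x) (𝓝 0) := by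
      have : Continuous fun y => b (k + 1) * ‖y - x‖ := by fun_prop
      have := (this.tendsto x).mono_left (nhdsWithin_le_nhds (s := K))
      simpa [Function.comp_def] using this.comp (Filter.tendsto_snd (f := (l : Filter ι)))
    -- Equicontinuity upgrades pointwise to joint, hence uniform, convergence.
    have h3 : Filter.Tendsto (fun y : ι × E => iteratedFDerivWithin ℝ k (c y.1) K y.2 -
        iteratedFDerivWithin ℝ k (c y.1) K x) ((l : Filter ι) ×ˢ 𝓝[K] x) (𝓝 0) := by
      refine squeeze_zero_norm' ?_ h2
      filter_upwards [Filter.tendsto_snd.eventually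
        (self_mem_nhdsWithin (a := x) (s := K))] with y hy
      exact hlip y.1 k x hx y.2 hy
    simpa using h3.add h1

end Compactness

/-! ### The topology of the Roumieu spaces on balls -/

/-- A set of reals is separable. If it has no maximum, each `{x | l < x}` is open and nonempty, so
it meets a dense sequence; partial suprema make that sequence monotone. -/
theorem WeightMatrix.exists_monotone_cofinal {Λ : Set ℝ} (𝔐 : WeightMatrix Λ) :
    ∃ u : ℕ → Λ, Monotone u ∧ ∀ l, ∃ i, l ≤ u i := by
  have : Nonempty Λ := 𝔐.nonempty.to_subtype
  by_cases hmax : ∃ m : Λ, ∀ l, l ≤ m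
  · obtain ⟨m, hm⟩ := hmax
    exact ⟨fun _ => m, monotone_const, fun l => ⟨0, hm l⟩⟩
  · push Not at hmax
    refine ⟨partialSups (TopologicalSpace.denseSeq Λ), OrderHom.monotone _, fun l => ?_⟩
    obtain ⟨l', hl'⟩ := hmax l
    have hopen : IsOpen {x : Λ | l < x} :=
      isOpen_lt continuous_const continuous_id
    obtain ⟨i, hi⟩ := (TopologicalSpace.denseRange_denseSeq Λ).exists_mem_open hopen ⟨l', hl'⟩
    exact ⟨i, (le_of_lt hi).trans (le_partialSups (TopologicalSpace.denseSeq Λ) i)⟩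


open Filter
open scoped Pointwise

/-! ### The topology of a single seminorm -/

section SeminormTopology

variable {E : Type*} [AddCommGroup E] [Module ℝ E] (p : Seminorm ℝ E)

theorem tendsto_nhds_seminorm_iff {ι : Type*} {l : Filter ι} {u : ι → E} {x : E} :
    Tendsto u l (@nhds _ p.toSeminormedAddCommGroup.toUniformSpace.toTopologicalSpace x) ↔
      Tendsto (fun a => p (u a - x)) l (𝓝 0) := by
  let := p.toSeminormedAddCommGroup
  exact tendsto_iff_norm_sub_tendsto_zero

theorem isTopologicalAddGroup_seminorm :
    @IsTopologicalAddGroup E p.toSeminormedAddCommGroup.toUniformSpace.toTopologicalSpace _ := by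
  let := p.toSeminormedAddCommGroup
  exact inferInstanceAs (IsTopologicalAddGroup E)

theorem continuousSMul_seminorm :
    @ContinuousSMul ℝ E _ _ p.toSeminormedAddCommGroup.toUniformSpace.toTopologicalSpace := by
  let := p.toSeminormedAddCommGroup
  let : NormedSpace ℝ E := ⟨fun a b => (map_smul_eq_mul p a b).le⟩
  exact inferInstanceAs (ContinuousSMul ℝ E)

theorem locallyConvexSpace_seminorm :
    @LocallyConvexSpace ℝ E _ _ _ _
      p.toSeminormedAddCommGroup.toUniformSpace.toTopologicalSpace := by
  let := p.toSeminormedAddCommGroup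
  let : NormedSpace ℝ E := ⟨fun a b => (map_smul_eq_mul p a b).le⟩
  exact inferInstanceAs (LocallyConvexSpace ℝ E)

theorem setOf_seminorm_lt_mem_nhds_zero {r : ℝ} (hr : 0 < r) :
    {x | p x < r} ∈ @nhds _ p.toSeminormedAddCommGroup.toUniformSpace.toTopologicalSpace 0 := by
  have h := (tendsto_nhds_seminorm_iff p (u := id) (x := 0)
    (l := @nhds _ p.toSeminormedAddCommGroup.toUniformSpace.toTopologicalSpace 0)).1 tendsto_id
  simp only [id, sub_zero] at h
  exact h.eventually_lt_const hr

end SeminormTopology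

/-! ### The local Roumieu space as a compact scale -/

section RoumieuLocal

variable {Λ : Set ℝ} (𝔐 : WeightMatrix Λ) (p m n : ℕ)

instance : IsTopologicalAddGroup (𝔐.RoumieuLocal p m n) :=
  topologicalAddGroup_sInf fun _ ht => ht.2.1

variable {𝔐 p m n}

theorem continuous_stepInclusion (l : Λ) (ρ : Set.Ioi (0 : ℝ)) :
    Continuous (stepInclusion 𝔐 p m n l ρ) :=
  continuous_sInf_rng.2 fun _ ht => ht.1 l ρ

theorem WeightMatrix.RoumieuLocal.contDiffOn (f : 𝔐.RoumieuLocal p m n) :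
    ContDiffOn ℝ ∞ f.1 (ball p n) := by
  obtain ⟨l, ρ, hρ, h⟩ := f.2
  exact h.1

theorem WeightMatrix.RoumieuLocal.eq_zero_of_notMem (f : 𝔐.RoumieuLocal p m n) {x : Eu p}
    (hx : x ∉ ball p n) : f.1 x = 0 := by
  obtain ⟨l, ρ, hρ, h⟩ := f.2
  exact h.2.1 x hx

theorem WeightMatrix.RoumieuLocal.iteratedFDerivWithin_sub (f g : 𝔐.RoumieuLocal p m n) {x : Eu p}
    (hx : x ∈ ball p n) (k : ℕ) :
    iteratedFDerivWithin ℝ k (f - g).1 (ball p n) x =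
      iteratedFDerivWithin ℝ k f.1 (ball p n) x - iteratedFDerivWithin ℝ k g.1 (ball p n) x :=
  iteratedFDerivWithin_sub_apply ((f.contDiffOn x hx).of_le (mod_cast le_top))
      ((g.contDiffOn x hx).of_le (mod_cast le_top)) (uniqueDiffOn_ball p n) hx

theorem stepNorm_eq {M : ℕ → ℝ} {ρ : ℝ} (f : Step p m n M ρ) :
    ENNReal.ofReal (stepNorm p m n M ρ f) =
    ultraNorm M ρ (ball p n) (fun k => iteratedFDerivWithin ℝ k f.1 (ball p n)) :=
  ENNReal.ofReal_toReal f.2.2.2.ne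

/-- Convergence in some step implies convergence in the inductive limit. -/
theorem WeightMatrix.RoumieuLocal.tendsto_of_tendsto_ultraNorm {ι : Type*} {a : Filter ι}
    {h : ι → 𝔐.RoumieuLocal p m n} {h₀ : 𝔐.RoumieuLocal p m n} (l : Λ) {ρ : ℝ} (hρ : 0 < ρ)
    (H : Tendsto (fun i => ultraNorm (𝔐.seq l) ρ (ball p n) (fun k x =>
      iteratedFDerivWithin ℝ k (h i).1 (ball p n) x -
        iteratedFDerivWithin ℝ k h₀.1 (ball p n) x)) a (𝓝 0)) :
    Tendsto h a (𝓝 h₀) := by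
  classical
  have hnorm : ∀ i, ultraNorm (𝔐.seq l) ρ (ball p n)
      (fun k => iteratedFDerivWithin ℝ k (h i - h₀).1 (ball p n)) =
      ultraNorm (𝔐.seq l) ρ (ball p n) (fun k x =>
      iteratedFDerivWithin ℝ k (h i).1 (ball p n) x -
        iteratedFDerivWithin ℝ k h₀.1 (ball p n) x) := fun i =>
    ultraNorm_congr _ _ _ fun x hx k => WeightMatrix.RoumieuLocal.iteratedFDerivWithin_sub _ _ hx k
  simp only [← hnorm] at H
  have hmem : ∀ᶠ i in a, (h i - h₀).1 ∈ stepSubmodule p m n (𝔐.seq l) ρ := by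
    filter_upwards [H.eventually_lt_const ENNReal.zero_lt_top] with i hi
    exact ⟨(h i - h₀).contDiffOn, fun x => (h i - h₀).eq_zero_of_notMem, hi⟩
  -- The default value `0` is taken only where the difference is outside the step, which eventually
  -- does not happen.
  let e : ι → Step p m n (𝔐.seq l) ρ := fun i =>
    if hi : (h i - h₀).1 ∈ stepSubmodule p m n (𝔐.seq l) ρ then ⟨(h i - h₀).1, hi⟩ else 0
  have he : Tendsto e a (𝓝 0) := by
    refine (tendsto_nhds_seminorm_iff (stepNorm p m n (𝔐.seq l) ρ)).2 ?_
    have h1 := (ENNReal.tendsto_toReal ENNReal.zero_ne_top).comp H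
    refine Tendsto.congr' ?_ h1
    filter_upwards [hmem] with i hi
    have : e i = ⟨(h i - h₀).1, hi⟩ := dif_pos hi
    rw [sub_zero, this]
    rfl
  have h2 := ((continuous_stepInclusion l ⟨ρ, hρ⟩).tendsto 0).comp he
  have h3 : Tendsto (fun i => h i - h₀) a (𝓝 0) := by
    refine Tendsto.congr' ?_ h2
    filter_upwards [hmem] with i hi
    have : e i = ⟨(h i - h₀).1, hi⟩ := dif_pos hi
    simp only [Function.comp_apply, this]
    rfl
  simpa using h3.add_const h₀

/-- The extended norms defining `ℰ^{\{𝔐\}}(K, ℝᵐ)` along a sequence in `Λ` and for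
`ρ = 1, 2, …`. -/
noncomputable def localNorm (u : ℕ → Λ) (i : ℕ) (f : 𝔐.RoumieuLocal p m n) : ℝ≥0∞ :=
  ultraNorm (𝔐.seq (u i)) (i + 1) (ball p n) (fun k => iteratedFDerivWithin ℝ k f.1 (ball p n))

theorem localNorm_le_of_le {u : ℕ → Λ} {l : Λ} {ρ : ℝ} (hρ : 0 < ρ) {i : ℕ} (hl : l ≤ u i)
    (hi : ρ ≤ i + 1) (f : 𝔐.RoumieuLocal p m n) :
    localNorm u i f ≤ ultraNorm (𝔐.seq l) ρ (ball p n)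
      (fun k => iteratedFDerivWithin ℝ k f.1 (ball p n)) :=
  ultraNorm_mono (𝔐.pos l) (𝔐.mono _ _ hl) hρ hi _ _

theorem localNorm_antitone {u : ℕ → Λ} (hu : Monotone u) :
    Antitone (localNorm u : ℕ → 𝔐.RoumieuLocal p m n → ℝ≥0∞) := fun i j hij f =>
  localNorm_le_of_le (by positivity) (hu hij) (by gcongr) f

theorem exists_step_le {u : ℕ → Λ} (hu : Monotone u) (hcof : ∀ l, ∃ i, l ≤ u i) (l : Λ) (ρ : ℝ) :
    ∃ i : ℕ, l ≤ u i ∧ ρ ≤ i + 1 := by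
  obtain ⟨i, hi⟩ := hcof l
  obtain ⟨j, hj⟩ := exists_nat_ge ρ
  refine ⟨max i j, hi.trans (hu (le_max_left _ _)), hj.trans ?_⟩
  have : (j : ℝ) ≤ (max i j : ℕ) := by exact_mod_cast le_max_right i j
  linarith

/-- Compactness is Arzelà–Ascoli for all derivatives at once, followed by `tendsto_ultraNorm_sub`.
The radius `i + 1` of step `i` increases strictly with `i`, as the latter requires, even if `u` is
constant. -/
theorem compactScale_localNorm {u : ℕ → Λ} (hu : Monotone u) (hcof : ∀ l, ∃ i, l ≤ u i) :
    CompactScale (localNorm u : ℕ → 𝔐.RoumieuLocal p m n → ℝ≥0∞) where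
  zero i := ultraNorm_zero _ _ _ fun x _ k => congrFun iteratedFDerivWithin_fun_zero x
  add_le i f g := ultraNorm_add_le _ _ _ fun x hx k =>
    iteratedFDerivWithin_add_apply ((f.contDiffOn x hx).of_le (mod_cast le_top))
      ((g.contDiffOn x hx).of_le (mod_cast le_top)) (uniqueDiffOn_ball p n) hx
  smul_le i c f := ultraNorm_smul_le _ _ _ c fun x hx k =>
    iteratedFDerivWithin_const_smul_apply ((f.contDiffOn x hx).of_le (mod_cast le_top))
      (uniqueDiffOn_ball p n) hx
  antitone := localNorm_antitone hu
  exists_lt_top f := by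
    obtain ⟨l, ρ, hρ, hf⟩ := f.2
    obtain ⟨i, hi, hi'⟩ := exists_step_le hu hcof l ρ
    exact ⟨i, (localNorm_le_of_le hρ hi hi' f).trans_lt hf.2.2⟩
  eq_zero i f hf := by
    refine Subtype.ext (funext fun x => ?_)
    by_cases hx : x ∈ ball p n
    · have h1 : localNorm u i f ≤ ENNReal.ofReal 0 := by simp [hf]
      have h2 := (ultraNorm_le_iff (𝔐.pos (u i)) (by positivity) le_rfl).1 h1 x hx 0
      rw [norm_iteratedFDerivWithin_zero, zero_mul] at h2
      exact norm_le_zero_iff.1 h2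
    · exact f.eq_zero_of_notMem hx
  compact i R c hc := by
    obtain ⟨h, hh, hh0, hhR, hlim⟩ := exists_tendstoUniformlyOn_iteratedFDerivWithin
      (hyperfilter ℕ) (𝔐.pos (u i)) (ρ := i + 1) (A := R) (by positivity) R.2
      (convex_closedBall (0 : Eu p) (n + 1)) (isCompact_ball p n) (uniqueDiffOn_ball p n)
      (c := fun a => (c a).1) (fun a => (c a).contDiffOn)
      (fun a => (hc a).trans_eq ENNReal.ofReal_coe_nnreal.symm)
    have hmem : h ∈ stepSubmodule p m n (𝔐.seq (u i)) (i + 1) :=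
      ⟨hh, hh0, hhR.trans_lt ENNReal.ofReal_lt_top⟩
    let h' : 𝔐.RoumieuLocal p m n := ⟨h, u i, i + 1, by positivity, hmem⟩
    refine ⟨h', hhR.trans_eq ENNReal.ofReal_coe_nnreal, ?_⟩
    have hpos : (0 : ℝ) < i + 1 := by positivity
    have hle : ∀ f : 𝔐.RoumieuLocal p m n, ultraNorm (𝔐.seq (u (i + 1))) (i + 1) (ball p n)
        (fun k => iteratedFDerivWithin ℝ k f.1 (ball p n)) ≤ localNorm u i f := fun f =>
      ultraNorm_mono (𝔐.pos _) (𝔐.mono _ _ (hu (Nat.le_succ i))) hpos le_rfl _ _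
    have key := tendsto_ultraNorm_sub (l := (hyperfilter ℕ : Filter ℕ)) (𝔐.pos (u (i + 1)))
      (ρ := i + 1) (ρ' := (i + 1 : ℕ) + 1)
      hpos (by push_cast; linarith) (K := ball p n)
      (P := fun a k => iteratedFDerivWithin ℝ k (c a).1 (ball p n))
      (Q := fun k => iteratedFDerivWithin ℝ k h (ball p n)) (A := R) R.2
      (Eventually.of_forall fun a => (hle (c a)).trans
        ((hc a).trans_eq ENNReal.ofReal_coe_nnreal.symm)) ((hle h').trans hhR) hlim
    refine key.congr fun a => Eq.symm ?_
    exact ultraNorm_congr _ _ _ fun x hx k =>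
      WeightMatrix.RoumieuLocal.iteratedFDerivWithin_sub _ _ hx k

/-- The gauge of `V` is a seminorm continuous on every step, so its topology competes in the infimum
defining the inductive limit. Its open unit ball lies in `V`. -/
theorem fineTopology_localNorm {u : ℕ → Λ} (hu : Monotone u) (hcof : ∀ l, ∃ i, l ≤ u i) :
    CompactScale.FineTopology (localNorm u : ℕ → 𝔐.RoumieuLocal p m n → ℝ≥0∞) := by
  have hS := compactScale_localNorm (p := p) (m := m) (n := n) (𝔐 := 𝔐) hu hcof
  intro V hV hVN
  have hgauge : ∀ i, ∃ C : ℝ, 0 < C ∧ ∀ f : 𝔐.RoumieuLocal p m n, ∀ s : ℝ, 0 < s →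
      localNorm u i f ≤ ENNReal.ofReal s → f ∈ (C * s) • V := by
    intro i
    obtain ⟨ε, hε, hεV⟩ := hVN i
    refine ⟨(ε : ℝ)⁻¹, by positivity, fun f s hs hf => ?_⟩
    have hε' : (0 : ℝ) < ε := hε
    have h0 : (ε : ℝ)⁻¹ * s ≠ 0 := by positivity
    rw [Set.mem_smul_set_iff_inv_smul_mem₀ h0]
    refine hεV _ ((hS.smul_le _ _ _).trans ?_)
    rw [Real.enorm_of_nonneg (by positivity)]
    calc _ ≤ ENNReal.ofReal (((ε : ℝ)⁻¹ * s)⁻¹) * ENNReal.ofReal s := by gcongr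
      _ = ε := by
        rw [← ENNReal.ofReal_mul (by positivity), ← ENNReal.ofReal_coe_nnreal]
        congr 1
        field_simp
  have habs : Absorbent ℝ V := by
    rw [absorbent_iff_forall_absorbs_singleton]
    intro f
    obtain ⟨i, hi⟩ := hS.exists_lt_top f
    obtain ⟨C, hC, h⟩ := hgauge i
    have h1 := h f ((localNorm u i f).toReal + 1) (by positivity) (by
      refine (ENNReal.ofReal_toReal hi.ne).symm.le.trans (ENNReal.ofReal_le_ofReal (by linarith)))
    rw [Absorbs]
    filter_upwards [eventually_cobounded_le_norm (C * ((localNorm u i f).toReal + 1))] with a ha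
    rw [Set.singleton_subset_iff]
    refine hV.1.smul_mono ?_ h1
    rwa [Real.norm_of_nonneg (by positivity)]
  let γ := gaugeSeminorm hV.1 hV.2 habs
  have hle : (inferInstance : TopologicalSpace (𝔐.RoumieuLocal p m n)) ≤
      γ.toSeminormedAddCommGroup.toUniformSpace.toTopologicalSpace := by
    refine sInf_le ⟨fun l ρ => ?_, isTopologicalAddGroup_seminorm γ, continuousSMul_seminorm γ,
      locallyConvexSpace_seminorm γ⟩
    obtain ⟨i, hi, hi'⟩ := exists_step_le hu hcof l ρ
    obtain ⟨C, hC, h⟩ := hgauge i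
    have hbound : ∀ f : Step p m n (𝔐.seq l) ρ, γ (stepInclusion 𝔐 p m n l ρ f) ≤
        C * stepNorm p m n (𝔐.seq l) ρ f := by
      intro f
      -- `hgauge` needs a positive radius, while the step norm may vanish; the slack `δ / C`
      -- provides one.
      refine le_of_forall_pos_le_add fun δ hδ => ?_
      have hnn : 0 ≤ stepNorm p m n (𝔐.seq l) ρ f := apply_nonneg _ _
      have h1 := h (stepInclusion 𝔐 p m n l ρ f) (stepNorm p m n (𝔐.seq l) ρ f + δ / C)
        (by positivity) (by
          refine (localNorm_le_of_le ρ.2 hi hi' _).trans ?_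
          refine (stepNorm_eq f).symm.le.trans (ENNReal.ofReal_le_ofReal ?_)
          have : 0 < δ / C := by positivity
          linarith)
      have h2 : γ (stepInclusion 𝔐 p m n l ρ f) ≤
          C * (stepNorm p m n (𝔐.seq l) ρ f + δ / C) := gauge_le_of_mem (by positivity) h1
      refine h2.trans_eq ?_
      field_simp
    refine (@continuous_iff_continuousAt _ _ _
      γ.toSeminormedAddCommGroup.toUniformSpace.toTopologicalSpace _).2 fun f₀ => ?_
    refine (tendsto_nhds_seminorm_iff γ).2 ?_
    have h1 : Tendsto (fun f => stepNorm p m n (𝔐.seq l) ρ (f - f₀)) (𝓝 f₀) (𝓝 0) :=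
      (tendsto_nhds_seminorm_iff (stepNorm p m n (𝔐.seq l) ρ) (u := id)).1 tendsto_id
    have h2 := h1.const_mul C
    rw [mul_zero] at h2
    exact squeeze_zero (fun f => apply_nonneg _ _) (fun f => hbound (f - f₀)) h2
  refine nhds_mono hle ?_
  refine mem_of_superset (setOf_seminorm_lt_mem_nhds_zero γ one_pos) fun x hx => ?_
  obtain ⟨ε, -, hεV⟩ := hVN 0
  exact setOfPred_gauge_lt_one_subset_self hV.2 (hεV 0 (by simp [hS.zero])) habs hx

end RoumieuLocal


/-! ### Bounds near a limit and maps into balls -/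

section Composition

variable {E F : Type*} [NormedAddCommGroup E] [NormedSpace ℝ E]
  [NormedAddCommGroup F] [NormedSpace ℝ F]

theorem ultraNorm_mono_set (M : ℕ → ℝ) (ρ : ℝ) {K L : Set E} (h : K ⊆ L)
    (P : ∀ k : ℕ, E → E [×k]→L[ℝ] F) : ultraNorm M ρ K P ≤ ultraNorm M ρ L P :=
  iSup₂_le fun _ hx => iSup_le fun k => le_ultraNorm M ρ P (h hx) k

theorem eventually_ultraNorm_le {ι : Type*} {l : Filter ι} {M : ℕ → ℝ} {ρ : ℝ} {K : Set E}
    {P : ι → ∀ k : ℕ, E → E [×k]→L[ℝ] F} {Q : ∀ k : ℕ, E → E [×k]→L[ℝ] F}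
    (hQ : ultraNorm M ρ K Q < ⊤)
    (h : Tendsto (fun a => ultraNorm M ρ K (fun k x => P a k x - Q k x)) l (𝓝 0)) :
    ∀ᶠ a in l, ultraNorm M ρ K (P a) ≤ ENNReal.ofReal ((ultraNorm M ρ K Q).toReal + 1) := by
  filter_upwards [h.eventually_le_const one_pos] with a ha
  rw [ENNReal.ofReal_add ENNReal.toReal_nonneg zero_le_one, ENNReal.ofReal_toReal hQ.ne,
    ENNReal.ofReal_one, add_comm]
  refine (ultraNorm_add_le M ρ K (P := fun k x => P a k x - Q k x) (Q := Q)
    fun x _ k => (sub_add_cancel _ _).symm).trans (add_le_add ha le_rfl)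

theorem le_ofReal_toReal_add_one {a : ℝ≥0∞} (ha : a < ⊤) : a ≤ ENNReal.ofReal (a.toReal + 1) :=
  (ENNReal.ofReal_toReal ha.ne).symm.le.trans (ENNReal.ofReal_le_ofReal (by linarith))

theorem exists_norm_le_of_isCompact {E : Type*} [NormedAddCommGroup E] {K : Set E}
    (hK : IsCompact K) :
    ∃ n : ℕ, ∀ x ∈ K, ‖x‖ ≤ n := by
  obtain ⟨R, hR⟩ := hK.isBounded.exists_norm_le
  obtain ⟨n, hn⟩ := exists_nat_ge R
  exact ⟨n, fun x hx => (hR x hx).trans hn⟩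

theorem exists_subset_ball {p : ℕ} {K : Set (Eu p)} (hK : IsCompact K) : ∃ n, K ⊆ ball p n := by
  obtain ⟨n, hn⟩ := exists_norm_le_of_isCompact hK
  refine ⟨n, fun x hx => mem_closedBall_zero_iff.2 ((hn x hx).trans (by linarith))⟩

theorem mapsTo_ball_of_norm_le {E : Type*} {q n : ℕ} {s : Set E} {g : E → Eu q}
    (hg : ∀ x ∈ s, ‖g x‖ ≤ n) : Set.MapsTo g s (ball q n) := fun x hx =>
  mem_closedBall_zero_iff.2 ((hg x hx).trans (by linarith))

/-- The ball of index `n` has radius `n + 1`, which leaves room for a perturbation of size one. -/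
theorem eventually_mapsTo_ball {ι : Type*} {l : Filter ι} {q n : ℕ} {s : Set E}
    {g : ι → E → Eu q} {g₀ : E → Eu q} (hg₀ : ∀ x ∈ s, ‖g₀ x‖ ≤ n)
    (h : TendstoUniformlyOn (fun a => iteratedFDerivWithin ℝ 0 (g a) s)
      (iteratedFDerivWithin ℝ 0 g₀ s) l s) :
    ∀ᶠ a in l, Set.MapsTo (g a) s (ball q n) := by
  filter_upwards [Metric.tendstoUniformlyOn_iff.1 h 1 one_pos] with a ha x hx
  have h1 := ha x hx
  rw [iteratedFDerivWithin_zero_eq_comp, iteratedFDerivWithin_zero_eq_comp, Function.comp_apply,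
    Function.comp_apply, LinearIsometryEquiv.dist_map, dist_comm, dist_eq_norm] at h1
  have h2 := norm_add_le (g a x - g₀ x) (g₀ x)
  rw [sub_add_cancel] at h2
  exact mem_closedBall_zero_iff.2 (by linarith [hg₀ x hx])

theorem exists_image_norm_le {E F : Type*} [TopologicalSpace E] [NormedAddCommGroup F]
    {s : Set E} (hs : IsCompact s) {g : E → F} (hg : ContinuousOn g s) :
    ∃ n : ℕ, ∀ x ∈ s, ‖g x‖ ≤ n := by
  obtain ⟨n, hn⟩ := exists_norm_le_of_isCompact (hs.image_of_continuousOn hg)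
  exact ⟨n, fun x hx => hn _ ⟨x, hx, rfl⟩⟩

end Composition

theorem iteratedFDerivWithin_ball {p m n : ℕ} {f : Eu p → Eu m} (hf : ContDiff ℝ ∞ f) {x : Eu p}
    (hx : x ∈ ball p n) (k : ℕ) :
    iteratedFDerivWithin ℝ k f (ball p n) x = iteratedFDeriv ℝ k f x :=
  iteratedFDerivWithin_eq_iteratedFDeriv (uniqueDiffOn_ball p n)
    (hf.of_le (mod_cast le_top)).contDiffAt hx

variable {Λ : Set ℝ} {𝔐 : WeightMatrix Λ} {p q r m n : ℕ}

/-! ### Composition in the Beurling spaces -/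

section Beurling

theorem WeightMatrix.Beurling.tendsto_iff {ι : Type*} {a : Filter ι} {f : ι → 𝔐.Beurling p m}
    {f₀ : 𝔐.Beurling p m} : Tendsto f a (𝓝 f₀) ↔
      ∀ (l : Λ) (K : Set (Eu p)), IsCompact K → ∀ ρ : ℝ, 0 < ρ →
        Tendsto (fun i => ultraNorm (𝔐.seq l) ρ K (fun k x =>
          iteratedFDeriv ℝ k (f i : Eu p → Eu m) x - iteratedFDeriv ℝ k (f₀ : Eu p → Eu m) x))
          a (𝓝 0) := by
  have hsub : ∀ i (x : Eu p) (k : ℕ), iteratedFDeriv ℝ k (f i - f₀ : 𝔐.Beurling p m).1 x =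
      iteratedFDeriv ℝ k (f i).1 x - iteratedFDeriv ℝ k f₀.1 x := fun i x k =>
    iteratedFDeriv_sub_apply ((f i).2.1.of_le (mod_cast le_top)).contDiffAt
      (f₀.2.1.of_le (mod_cast le_top)).contDiffAt
  have h1 : Tendsto f a (𝓝 f₀) ↔ ∀ i : Λ × TopologicalSpace.Compacts (Eu p) × Set.Ioi (0 : ℝ),
      Tendsto (fun j => beurlingSeminorm 𝔐 i.1 i.2.1 i.2.2 (f j - f₀)) a (𝓝 0) := by
    rw [nhds_iInf, tendsto_iInf]
    exact forall_congr' fun i => tendsto_nhds_seminorm_iff _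
  have h2 : ∀ (l : Λ) (K : TopologicalSpace.Compacts (Eu p)) (ρ : Set.Ioi (0 : ℝ)),
      Tendsto (fun j => beurlingSeminorm 𝔐 l K ρ (f j - f₀)) a (𝓝 0) ↔
      Tendsto (fun i => ultraNorm (𝔐.seq l) ρ K (fun k x =>
          iteratedFDeriv ℝ k (f i).1 x - iteratedFDeriv ℝ k f₀.1 x)) a (𝓝 0) := by
    intro l K ρ
    have h3 : ∀ i, ultraNorm (𝔐.seq l) ρ K (fun k x =>
          iteratedFDeriv ℝ k (f i).1 x - iteratedFDeriv ℝ k f₀.1 x) =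
        ENNReal.ofReal (beurlingSeminorm 𝔐 l K ρ (f i - f₀)) := by
      intro i
      refine Eq.trans ?_ (ENNReal.ofReal_toReal ((f i - f₀).2.2 l K K.isCompact ρ ρ.2).ne).symm
      exact ultraNorm_congr _ _ _ fun x _ k => (hsub i x k).symm
    simp only [h3]
    constructor
    · intro h
      simpa using ENNReal.tendsto_ofReal h
    · intro h
      have := (ENNReal.tendsto_toReal ENNReal.zero_ne_top).comp h
      simpa [Function.comp_def, ENNReal.toReal_ofReal (apply_nonneg _ _)] using this
  rw [h1]
  exact ⟨fun h l K hK ρ hρ => (h2 l ⟨K, hK⟩ ⟨ρ, hρ⟩).1 (h ⟨l, ⟨K, hK⟩, ⟨ρ, hρ⟩⟩),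
    fun h i => (h2 _ _ _).2 (h i.1 i.2.1 i.2.1.isCompact i.2.2 i.2.2.2)⟩

theorem WeightMatrix.Beurling.ultraNorm_within_lt_top (f : 𝔐.Beurling p m) (l : Λ) (n : ℕ) {ρ : ℝ}
    (hρ : 0 < ρ) : ultraNorm (𝔐.seq l) ρ (ball p n)
      (fun k => iteratedFDerivWithin ℝ k f.1 (ball p n)) < ⊤ := by
  rw [ultraNorm_congr _ _ _ fun x hx k => iteratedFDerivWithin_ball f.2.1 hx k]
  exact f.2.2 l _ (isCompact_ball p n) ρ hρ

theorem WeightMatrix.Beurling.tendsto_ultraNorm_within {ι : Type*} {a : Filter ι}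
    {f : ι → 𝔐.Beurling p m} {f₀ : 𝔐.Beurling p m} (h : Tendsto f a (𝓝 f₀)) (l : Λ) (n : ℕ) {ρ : ℝ}
    (hρ : 0 < ρ) :
    Tendsto (fun i => ultraNorm (𝔐.seq l) ρ (ball p n) (fun k x =>
      iteratedFDerivWithin ℝ k (f i).1 (ball p n) x -
        iteratedFDerivWithin ℝ k f₀.1 (ball p n) x)) a (𝓝 0) := by
  refine (tendsto_iff.1 h l _ (isCompact_ball p n) ρ hρ).congr fun i => ?_
  exact ultraNorm_congr _ _ _ fun x hx k => by
    rw [iteratedFDerivWithin_ball (f i).2.1 hx, iteratedFDerivWithin_ball f₀.2.1 hx]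

theorem WeightMatrix.FdBBeurling.tendsto_comp (h : 𝔐.FdBBeurling) {ι : Type*} {a : Filter ι}
    {g : ι → 𝔐.Beurling p q} {g₀ : 𝔐.Beurling p q} {f : ι → 𝔐.Beurling q r}
    {f₀ : 𝔐.Beurling q r} (hg : Tendsto g a (𝓝 g₀)) (hf : Tendsto f a (𝓝 f₀)) (l : Λ)
    {K : Set (Eu p)} (hK : IsCompact K) {ρ : ℝ} (hρ : 0 < ρ) :
    Tendsto (fun i => ultraNorm (𝔐.seq l) ρ K (fun k x =>
      iteratedFDeriv ℝ k ((f i).1 ∘ (g i).1) x - iteratedFDeriv ℝ k (f₀.1 ∘ g₀.1) x))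
      a (𝓝 0) ∧
    ultraNorm (𝔐.seq l) ρ K (fun k x => iteratedFDeriv ℝ k (f₀.1 ∘ g₀.1) x) < ⊤ := by
  obtain ⟨μ, C, hC, τ, hτ, hμ⟩ := h l
  obtain ⟨n, hn⟩ := exists_subset_ball hK
  obtain ⟨n', hn'⟩ := exists_image_norm_le (isCompact_ball p n) g₀.2.1.continuous.continuousOn
  -- With `σ * B = 1` the composition has radius `(2 + 1) * ρg * τ = ρ / 2`, strictly below `ρ`. The
  -- order of choice matters: `B` depends on `ρg`, then `σ` on `B`, then `A` on `σ`.
  set ρg : ℝ := ρ / (6 * τ) with hρg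
  have hρg0 : 0 < ρg := by positivity
  set B : ℝ := (ultraNorm (𝔐.seq μ) ρg (ball p n)
    (fun k => iteratedFDerivWithin ℝ k g₀.1 (ball p n))).toReal + 1 with hB
  have hB0 : 0 < B := by positivity
  set σ : ℝ := B⁻¹
  have hσ : 0 < σ := by positivity
  set A : ℝ := (ultraNorm (𝔐.seq μ) σ (ball q n')
    (fun k => iteratedFDerivWithin ℝ k f₀.1 (ball q n'))).toReal + 1 with hA
  have hA0 : 0 < A := by positivity
  have hgl := Beurling.tendsto_ultraNorm_within hg μ n hρg0
  have hfl := Beurling.tendsto_ultraNorm_within hf μ n' hσ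
  have hgu := tendstoUniformlyOn_of_tendsto_ultraNorm_sub (𝔐.pos μ) hρg0 hgl
  have hfu := tendstoUniformlyOn_of_tendsto_ultraNorm_sub (𝔐.pos μ) hσ hfl
  have hlt : (2 + σ * B) * ρg * τ < ρ := by
    have : σ * B = 1 := inv_mul_cancel₀ hB0.ne'
    rw [this, hρg]
    field_simp
    norm_num
  have hgB₀ := le_ofReal_toReal_add_one (g₀.ultraNorm_within_lt_top μ n hρg0)
  have hfA₀ := le_ofReal_toReal_add_one (f₀.ultraNorm_within_lt_top μ n' hσ)
  constructor
  · have key := tendsto_ultraNorm_comp_sub (𝔐.pos μ) (𝔐.zero_eq_one μ) (𝔐.pos l) hC hτ hμ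
      (uniqueDiffOn_ball p n) (isCompact_ball p n) (uniqueDiffOn_ball q n')
      (Eventually.of_forall fun i => (g i).2.1.contDiffOn)
      (Eventually.of_forall fun i => (f i).2.1.contDiffOn)
      (eventually_mapsTo_ball hn' (hgu 0)) g₀.2.1.contDiffOn f₀.2.1.contDiffOn
      (mapsTo_ball_of_norm_le hn') hA0.le hB0.le hρg0 hσ hlt
      (eventually_ultraNorm_le (g₀.ultraNorm_within_lt_top μ n hρg0) hgl)
      (eventually_ultraNorm_le (f₀.ultraNorm_within_lt_top μ n' hσ) hfl)
      hgB₀ hfA₀ hgu hfu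
    refine tendsto_of_tendsto_of_tendsto_of_le_of_le tendsto_const_nhds key
      (fun _ => zero_le) fun i => ?_
    refine (ultraNorm_mono_set _ _ hn _).trans_eq (ultraNorm_congr _ _ _ fun x hx k => ?_)
    rw [iteratedFDerivWithin_ball ((f i).2.1.comp (g i).2.1) hx,
      iteratedFDerivWithin_ball (f₀.2.1.comp g₀.2.1) hx]
  · have key := ultraNorm_comp_le (𝔐.pos μ) (𝔐.zero_eq_one μ) (𝔐.pos l) hC hτ hμ
      (uniqueDiffOn_ball p n) (uniqueDiffOn_ball q n') g₀.2.1.contDiffOn f₀.2.1.contDiffOn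
      (mapsTo_ball_of_norm_le hn') hA0.le hB0.le hρg0 hσ hgB₀ hfA₀
    refine lt_of_le_of_lt ?_ (key.trans_lt ENNReal.ofReal_lt_top)
    refine (ultraNorm_mono_set _ _ hn _).trans ((ultraNorm_mono (𝔐.pos l) (fun _ => le_rfl)
      (by positivity) hlt.le _ _).trans_eq (ultraNorm_congr _ _ _ fun x hx k => ?_))
    rw [iteratedFDerivWithin_ball (f₀.2.1.comp g₀.2.1) hx]

/-- Composition in the Beurling spaces. -/
def WeightMatrix.FdBBeurling.comp (h : 𝔐.FdBBeurling) (z : 𝔐.Beurling p q × 𝔐.Beurling q r) :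
    𝔐.Beurling p r :=
  ⟨z.2.1 ∘ z.1.1, z.2.2.1.comp z.1.2.1, fun l _ hK _ hρ =>
    -- Only the finiteness half is wanted, so the convergence hypotheses are made void by the filter
    -- `⊥`.
    (h.tendsto_comp (a := ⊥) (ι := Unit) (g := fun _ => z.1) (f := fun _ => z.2)
      tendsto_bot tendsto_bot l hK hρ).2⟩

theorem WeightMatrix.FdBBeurling.continuous_comp (h : 𝔐.FdBBeurling) :
    Continuous (h.comp (p := p) (q := q) (r := r)) := by
  refine continuous_iff_continuousAt.2 fun z => Beurling.tendsto_iff.2 fun l K hK ρ hρ => ?_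
  exact (h.tendsto_comp (continuous_fst.tendsto z) (continuous_snd.tendsto z) l hK hρ).1

end Beurling

/-! ### Composition in the Roumieu spaces -/

section Roumieu

open scoped NNReal

theorem localNorm_sub (u : ℕ → Λ) (i : ℕ) (f g : 𝔐.RoumieuLocal p m n) :
    localNorm u i (f - g) = ultraNorm (𝔐.seq (u i)) (i + 1) (ball p n) (fun k x =>
      iteratedFDerivWithin ℝ k f.1 (ball p n) x - iteratedFDerivWithin ℝ k g.1 (ball p n) x) :=
  ultraNorm_congr _ _ _ fun _ hx k => WeightMatrix.RoumieuLocal.iteratedFDerivWithin_sub _ _ hx k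

theorem iteratedFDerivWithin_restrict (f : 𝔐.Roumieu p m) {x : Eu p} (hx : x ∈ ball p n) (k : ℕ) :
    iteratedFDerivWithin ℝ k (restrict 𝔐 n f).1 (ball p n) x =
      iteratedFDerivWithin ℝ k f.1 (ball p n) x :=
  iteratedFDerivWithin_congr Set.eqOn_indicator hx k

theorem localNorm_restrict (u : ℕ → Λ) (i : ℕ) (f : 𝔐.Roumieu p m) (n : ℕ) :
    localNorm u i (restrict 𝔐 n f) = ultraNorm (𝔐.seq (u i)) (i + 1) (ball p n)
      (fun k => iteratedFDerivWithin ℝ k f.1 (ball p n)) :=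
  ultraNorm_congr _ _ _ fun _ hx k => iteratedFDerivWithin_restrict f hx k

theorem localNorm_restrict_sub (u : ℕ → Λ) (i : ℕ) (f g : 𝔐.Roumieu p m) (n : ℕ) :
    localNorm u i (restrict 𝔐 n f - restrict 𝔐 n g) =
      ultraNorm (𝔐.seq (u i)) (i + 1) (ball p n) (fun k x =>
        iteratedFDerivWithin ℝ k f.1 (ball p n) x - iteratedFDerivWithin ℝ k g.1 (ball p n) x) :=
  (localNorm_sub u i _ _).trans (ultraNorm_congr _ _ _ fun _ hx k => congrArg₂ (· - ·)
    (iteratedFDerivWithin_restrict f hx k) (iteratedFDerivWithin_restrict g hx k))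

theorem iteratedFDerivWithin_indicator_ball (f : Eu p → Eu m) {x : Eu p} (hx : x ∈ ball p n)
    (k : ℕ) : iteratedFDerivWithin ℝ k ((ball p n).indicator f) (ball p n) x =
      iteratedFDerivWithin ℝ k f (ball p n) x :=
  iteratedFDerivWithin_congr Set.eqOn_indicator hx k

theorem exists_localNorm_lt_top {u : ℕ → Λ} (hu : Monotone u) (hcof : ∀ l, ∃ i, l ≤ u i)
    (f : 𝔐.RoumieuLocal p m n) (i : ℕ) : ∃ j ≥ i, ∀ k ≥ j, localNorm u k f < ⊤ := by
  obtain ⟨j, hj⟩ := (compactScale_localNorm hu hcof).exists_lt_top f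
  exact ⟨max i j, le_max_left _ _, fun k hk =>
    (localNorm_antitone hu ((le_max_right i j).trans hk) f).trans_lt hj⟩

theorem tendsto_localNorm_of_le {ι : Type*} {a : Filter ι} {u : ℕ → Λ} (hu : Monotone u)
    {f : ι → 𝔐.RoumieuLocal p m n} {i j : ℕ} (hij : i ≤ j)
    (hf : Tendsto (fun b => localNorm u i (f b)) a (𝓝 0)) :
    Tendsto (fun b => localNorm u j (f b)) a (𝓝 0) :=
  tendsto_of_tendsto_of_tendsto_of_le_of_le tendsto_const_nhds hf (fun _ => zero_le)
    fun b => localNorm_antitone hu hij (f b)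

/-- The norms decrease along the scale, so one index `J` serves both `g` and `f` on a ball
containing the image of `g`. -/
theorem WeightMatrix.FdBRoumieu.comp_mem (h : 𝔐.FdBRoumieu) (f : 𝔐.Roumieu q r)
    (g : 𝔐.RoumieuLocal p q n) :
    (ball p n).indicator (f.1 ∘ g.1) ∈ localSubmodule 𝔐 p r n := by
  obtain ⟨u, hu, hcof⟩ := 𝔐.exists_monotone_cofinal
  obtain ⟨n', hn'⟩ := exists_image_norm_le (isCompact_ball p n) g.contDiffOn.continuousOn
  obtain ⟨j, -, hj⟩ := exists_localNorm_lt_top hu hcof g 0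
  obtain ⟨J, hJ, hJf⟩ := exists_localNorm_lt_top hu hcof (restrict 𝔐 n' f) j
  obtain ⟨μ, C, hC, τ, hτ, hμ⟩ := h (u J)
  obtain ⟨B, hB, hg⟩ : ∃ B : ℝ, 0 ≤ B ∧ localNorm u J g ≤ ENNReal.ofReal B :=
    ⟨_, by positivity, le_ofReal_toReal_add_one (hj J hJ)⟩
  have hf := le_ofReal_toReal_add_one ((localNorm_restrict u J f n').symm.trans_lt (hJf J le_rfl))
  have hpos : (0 : ℝ) < J + 1 := by positivity
  have key := ultraNorm_comp_le (𝔐.pos (u J)) (𝔐.zero_eq_one (u J)) (𝔐.pos μ) hC hτ hμ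
      (uniqueDiffOn_ball p n) (uniqueDiffOn_ball q n') g.contDiffOn f.2.1.contDiffOn
      (mapsTo_ball_of_norm_le hn') (by positivity) hB hpos hpos hg hf
  refine ⟨μ, (2 + (J + 1) * B) * (J + 1) * τ, by positivity,
    (f.2.1.comp_contDiffOn g.contDiffOn).congr Set.eqOn_indicator,
    fun x hx => Set.indicator_of_notMem hx _, ?_⟩
  rw [ultraNorm_congr _ _ _ fun x hx k => iteratedFDerivWithin_indicator_ball _ hx k]
  exact key.trans_lt ENNReal.ofReal_lt_top

/-- The composition `f ∘ g` on a ball. -/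
noncomputable def WeightMatrix.FdBRoumieu.localComp (h : 𝔐.FdBRoumieu) (f : 𝔐.Roumieu q r)
    (g : 𝔐.RoumieuLocal p q n) : 𝔐.RoumieuLocal p r n :=
  ⟨(ball p n).indicator (f.1 ∘ g.1), h.comp_mem f g⟩

/-- Convergence of `f` is assumed on every ball because the relevant one depends on the image of
`g₀`. Past a common index `J` both norms are finite and both convergences hold; the limit is then
taken in a single step of the target. -/
theorem WeightMatrix.FdBRoumieu.tendsto_localComp (h : 𝔐.FdBRoumieu) {u : ℕ → Λ} (hu : Monotone u)
    (hcof : ∀ l, ∃ i, l ≤ u i) {ι : Type*} {a : Filter ι}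
    {g : ι → 𝔐.RoumieuLocal p q n} {g₀ : 𝔐.RoumieuLocal p q n} {f : ι → 𝔐.Roumieu q r}
    {f₀ : 𝔐.Roumieu q r} {i : ℕ} (hg : Tendsto (fun b => localNorm u i (g b - g₀)) a (𝓝 0))
    (hf : ∀ n', ∃ i', Tendsto (fun b => localNorm u i' (restrict 𝔐 n' (f b) - restrict 𝔐 n' f₀))
      a (𝓝 0)) :
    Tendsto (fun b => h.localComp (f b) (g b)) a (𝓝 (h.localComp f₀ g₀)) := by
  obtain ⟨n', hn'⟩ := exists_image_norm_le (isCompact_ball p n) g₀.contDiffOn.continuousOn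
  obtain ⟨i', hf⟩ := hf n'
  obtain ⟨j, hij, hj⟩ := exists_localNorm_lt_top hu hcof g₀ (max i i')
  obtain ⟨J, hJ, hJf⟩ := exists_localNorm_lt_top hu hcof (restrict 𝔐 n' f₀) j
  have hJg := hj J hJ
  have hJf := hJf J le_rfl
  obtain ⟨μ, C, hC, τ, hτ, hμ⟩ := h (u J)
  have hpos : (0 : ℝ) < J + 1 := by positivity
  have hgl := tendsto_localNorm_of_le hu ((le_max_left i i').trans (hij.le.trans hJ)) hg
  have hfl := tendsto_localNorm_of_le hu ((le_max_right i i').trans (hij.le.trans hJ)) hf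
  simp only [localNorm_sub] at hgl
  simp only [localNorm_restrict_sub] at hfl
  rw [localNorm_restrict] at hJf
  have hgu := tendstoUniformlyOn_of_tendsto_ultraNorm_sub (𝔐.pos (u J)) hpos hgl
  have hfu := tendstoUniformlyOn_of_tendsto_ultraNorm_sub (𝔐.pos (u J)) hpos hfl
  obtain ⟨B, hB, hgB₀, hgB⟩ : ∃ B : ℝ, 0 ≤ B ∧
      ultraNorm (𝔐.seq (u J)) (J + 1) (ball p n)
        (fun k => iteratedFDerivWithin ℝ k g₀.1 (ball p n)) ≤ ENNReal.ofReal B ∧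
      ∀ᶠ b in a, ultraNorm (𝔐.seq (u J)) (J + 1) (ball p n)
        (fun k => iteratedFDerivWithin ℝ k (g b).1 (ball p n)) ≤ ENNReal.ofReal B :=
    ⟨_, by positivity, le_ofReal_toReal_add_one hJg, eventually_ultraNorm_le hJg hgl⟩
  obtain ⟨A, hA, hfA₀, hfA⟩ : ∃ A : ℝ, 0 ≤ A ∧
      ultraNorm (𝔐.seq (u J)) (J + 1) (ball q n')
        (fun k => iteratedFDerivWithin ℝ k f₀.1 (ball q n')) ≤ ENNReal.ofReal A ∧
      ∀ᶠ b in a, ultraNorm (𝔐.seq (u J)) (J + 1) (ball q n')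
        (fun k => iteratedFDerivWithin ℝ k (f b).1 (ball q n')) ≤ ENNReal.ofReal A :=
    ⟨_, by positivity, le_ofReal_toReal_add_one hJf, eventually_ultraNorm_le hJf hfl⟩
  have key := tendsto_ultraNorm_comp_sub (𝔐.pos (u J)) (𝔐.zero_eq_one (u J)) (𝔐.pos μ) hC hτ hμ
    (uniqueDiffOn_ball p n) (isCompact_ball p n) (uniqueDiffOn_ball q n')
    (Eventually.of_forall fun i => (g i).contDiffOn)
    (Eventually.of_forall fun i => (f i).2.1.contDiffOn)
    (eventually_mapsTo_ball hn' (hgu 0)) g₀.contDiffOn f₀.2.1.contDiffOn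
    (mapsTo_ball_of_norm_le hn') hA hB hpos hpos (lt_add_one ((2 + (J + 1) * B) * (J + 1) * τ))
    hgB hfA hgB₀ hfA₀ hgu hfu
  refine RoumieuLocal.tendsto_of_tendsto_ultraNorm μ
    (ρ := (2 + (J + 1) * B) * (J + 1) * τ + 1) (by positivity) (key.congr fun b => ?_)
  refine ultraNorm_congr _ _ _ fun x hx k => ?_
  exact congrArg₂ (· - ·) (iteratedFDerivWithin_indicator_ball _ hx k).symm
    (iteratedFDerivWithin_indicator_ball _ hx k).symm

theorem WeightMatrix.FdBRoumieu.continuous_localComp (h : 𝔐.FdBRoumieu) (f : 𝔐.Roumieu q r) :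
    Continuous (h.localComp f : 𝔐.RoumieuLocal p q n → 𝔐.RoumieuLocal p r n) := by
  obtain ⟨u, hu, hcof⟩ := 𝔐.exists_monotone_cofinal
  refine continuous_def.2 fun U hU => (compactScale_localNorm hu hcof).isOpen
    (fineTopology_localNorm hu hcof) fun g hg i => ?_
  -- The pulled-back filter is that of the `localNorm u i` neighbourhoods of `g`, so this is
  -- continuity at step `i`.
  have h1 : Tendsto (h.localComp f) (comap (fun g' => localNorm u i (g' - g)) (𝓝 0))
      (𝓝 (h.localComp f g)) := by
    refine h.tendsto_localComp hu hcof (g := id) (f := fun _ => f) (i := i) tendsto_comap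
      fun n' => ⟨0, ?_⟩
    simp only [sub_self, (compactScale_localNorm hu hcof).zero]
    exact tendsto_const_nhds
  obtain ⟨ε, hε, hεU⟩ := ((ENNReal.nhds_zero_basis_Iic.comap _).mem_iff).1
    (h1 (hU.mem_nhds hg))
  obtain ⟨δ, hδ, hδε⟩ := ENNReal.lt_iff_exists_nnreal_btwn.1 hε
  exact ⟨δ, by exact_mod_cast hδ, fun y hy => hεU (hy.trans hδε.le)⟩

theorem WeightMatrix.Roumieu.tendsto_iff {ι : Type*} {a : Filter ι} {f : ι → 𝔐.Roumieu p m}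
    {f₀ : 𝔐.Roumieu p m} : Tendsto f a (𝓝 f₀) ↔
      ∀ n, Tendsto (fun i => restrict 𝔐 n (f i)) a (𝓝 (restrict 𝔐 n f₀)) := by
  rw [nhds_iInf, tendsto_iInf]
  refine forall_congr' fun n => ?_
  rw [nhds_induced, tendsto_comap_iff]
  rfl

theorem continuous_restrict (n : ℕ) :
    Continuous (restrict 𝔐 n : 𝔐.Roumieu p m → 𝔐.RoumieuLocal p m n) :=
  continuous_iff_continuousAt.2 fun _ => WeightMatrix.Roumieu.tendsto_iff.1 tendsto_id n

theorem indicator_comp_restrict (g : 𝔐.Roumieu p q) (f : Eu q → Eu r) :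
    (ball p n).indicator (f ∘ g.1) = (ball p n).indicator (f ∘ (restrict 𝔐 n g).1) := by
  refine Set.indicator_congr fun x hx => ?_
  exact congrArg f (Set.indicator_of_mem hx g.1).symm

/-- Composition in the Roumieu spaces. -/
def WeightMatrix.FdBRoumieu.comp (h : 𝔐.FdBRoumieu) (z : 𝔐.Roumieu p q × 𝔐.Roumieu q r) :
    𝔐.Roumieu p r :=
  ⟨z.2.1 ∘ z.1.1, z.2.2.1.comp z.1.2.1, fun K hK => by
    obtain ⟨n, hn⟩ := exists_subset_ball hK
    obtain ⟨l, ρ, hρ, -, -, hlt⟩ := h.comp_mem z.2 (restrict 𝔐 n z.1)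
    refine ⟨l, ρ, hρ, ((ultraNorm_mono_set _ _ hn _).trans_eq
      (ultraNorm_congr _ _ _ fun x hx k => ?_)).trans_lt hlt⟩
    rw [← indicator_comp_restrict, iteratedFDerivWithin_indicator_ball _ hx,
      iteratedFDerivWithin_ball (z.2.2.1.comp z.1.2.1) hx]⟩

theorem WeightMatrix.FdBRoumieu.restrict_comp (h : 𝔐.FdBRoumieu)
    (z : 𝔐.Roumieu p q × 𝔐.Roumieu q r) :
    restrict 𝔐 n (h.comp z) = h.localComp z.2 (restrict 𝔐 n z.1) :=
  Subtype.ext (indicator_comp_restrict z.1 z.2.1)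

theorem WeightMatrix.FdBRoumieu.continuous_comp_left (h : 𝔐.FdBRoumieu) (f : 𝔐.Roumieu q r) :
    Continuous fun g : 𝔐.Roumieu p q => h.comp (g, f) := by
  refine continuous_iff_continuousAt.2 fun g => Roumieu.tendsto_iff.2 fun n => ?_
  simp only [h.restrict_comp]
  exact ((h.continuous_localComp f).comp (continuous_restrict n)).tendsto g

/-- This is where sequences are needed: on each ball a convergent sequence converges in a single
step, whose index may depend on the ball. -/
theorem WeightMatrix.Roumieu.exists_tendsto_localNorm {u : ℕ → Λ} (hu : Monotone u)
    (hcof : ∀ l, ∃ i, l ≤ u i) {f : ℕ → 𝔐.Roumieu p m} {f₀ : 𝔐.Roumieu p m}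
    (hf : Tendsto f atTop (𝓝 f₀)) (n : ℕ) :
    ∃ i, Tendsto (fun b => localNorm u i (restrict 𝔐 n (f b) - restrict 𝔐 n f₀))
      atTop (𝓝 0) := by
  refine (compactScale_localNorm hu hcof).exists_tendsto (fineTopology_localNorm hu hcof) ?_
  simpa using (Roumieu.tendsto_iff.1 hf n).sub_const (restrict 𝔐 n f₀)

theorem WeightMatrix.FdBRoumieu.seqContinuous_comp (h : 𝔐.FdBRoumieu) :
    SeqContinuous (h.comp (p := p) (q := q) (r := r)) := by
  obtain ⟨u, hu, hcof⟩ := 𝔐.exists_monotone_cofinal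
  intro z z₀ hz
  have hg := (continuous_fst.tendsto z₀).comp hz
  have hf := (continuous_snd.tendsto z₀).comp hz
  refine Roumieu.tendsto_iff.2 fun n => ?_
  simp only [Function.comp_apply, h.restrict_comp]
  obtain ⟨i, hi⟩ := Roumieu.exists_tendsto_localNorm hu hcof hg n
  exact h.tendsto_localComp hu hcof hi (Roumieu.exists_tendsto_localNorm hu hcof hf)

end Roumieu

end Ultra

theorem theorem4p13 {Λ : Set ℝ} (𝔐 : Ultra.WeightMatrix Λ) (p q r : ℕ) :
    (𝔐.FdBBeurling →
      ∃ comp : 𝔐.Beurling p q × 𝔐.Beurling q r → 𝔐.Beurling p r,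
        (∀ g f x, comp (g, f) x = f (g x)) ∧ Continuous comp) ∧
    (𝔐.FdBRoumieu →
      ∃ comp : 𝔐.Roumieu p q × 𝔐.Roumieu q r → 𝔐.Roumieu p r,
        (∀ g f x, comp (g, f) x = f (g x)) ∧
        (∀ f : 𝔐.Roumieu q r, Continuous fun g : 𝔐.Roumieu p q => comp (g, f)) ∧
        SeqContinuous comp) :=
  ⟨fun h => ⟨h.comp, fun _ _ _ => rfl, h.continuous_comp⟩,
    fun h => ⟨h.comp, fun _ _ _ => rfl, h.continuous_comp_left, h.seqContinuous_comp⟩⟩
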